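/- **Setting.** Let $d\ge 2$. For $\mathfrak d\in\{1,\dots,d\}$ let $A_{(\mathfrak d)}$ be the diagonal $d\times d$ matrix with $\mathfrak d$-th diagonal entry $4$ and all others $2$, and for $\ell=(\ell_1,\dots,\ell_{d-1})\in\mathbb Z^{d-1}$ let $B^{[\ell]}_{(\mathfrak d)}$ be the identity matrix whose $\mathfrak d$-th row is changed by putting $\ell_1,\dots,\ell_{d-1}$ in its off-diagonal places. With $Q_0=[0,1)^d$ put $$Q^{(\mathfrak d)}_{j,\ell,k}=A_{(\mathfrak d)}^{-j}B^{[-\ell]}_{(\mathfrak d)}(Q_0+k),\qquad \mathfrak d=1,\dots,d,\ j\ge 0,\ |\ell_i|\le 2^j,\ k\in\mathbb Z^d ,$$ so $|Q^{(\mathfrak d)}_{j,\ell,k}|=2^{-(d+1)j}$. Let $\mathcal Q_{AB}$ be the set of the indices $(\mathfrak d,j,\ell,k)$ (identified with the $Q$'s), together with the coarse indices $k\in\mathbb Z^d$, to which we attach the cubes $Q_0+k$ of measure $1$; let $S$ be the space of all complex sequences $\mathbf s=\{s_Q\}$ indexed by $\mathcal Q_{AB}$, with coarse entries $s_k$. For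 $s\in\mathbb R$, $0<p,q\le\infty$, the space $\mathbf b^{s,q}_p(AB)$ consists of all $\mathbf s\in S$ with $$\|\mathbf s\|_{\mathbf b^{s,q}_p(AB)}=\Big(\sum_{k}|s_k|^p\Big)^{1/p}+\Big(\sum_{\mathfrak d}\sum_{j\ge0}\sum_{|\ell_i|\le 2^j}\Big(\sum_{k\in\mathbb Z^d,\ Q=Q^{(\mathfrak d)}_{j,\ell,k}}\big[|Q|^{-s+\frac1p-\frac12}|s_Q|\big]^p\Big)^{q/p}\Big)^{1/q}<\infty$$ (usual modifications for $p$ or $q=\infty$). For $\alpha\in\mathbb R$ let $\nu_\alpha(\Gamma)=\sum_{Q\in\Gamma}|Q|^\alpha$. For a quasi-normed sequence space $\mathfrak f\subset S$ let $\sigma_{\nu}(t,\mathbf s)=\inf\|\mathbf s-\mathbf t\|_{\mathfrak f}$, the infimum over all $\mathbf t\in S$ vanishing outside some $\Gamma$ with $\nu(\Gamma)\le t$, and let $\mathcal A^\xi_\mu(\mathfrak f,\nu)$ ($0<\xi<\infty$, $0<\mu\le\infty$) be the set of $\mathbf s\in S$ with $\|\mathbf s\|_{\mathcal A^\xi_\mu(\mathfrak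 f,\nu)}=\big(\int_0^\infty[t^\xi\sigma_\nu(t,\mathbf s)]^\mu\frac{dt}t\big)^{1/\mu}<\infty$ (a supremum over $t>0$ if $\mu=\infty$). For a weight $\mathbf u$, $\ell^{r,\mu}(\mathbf u,\nu)$ is the discrete weighted Lorentz space with quasi-norm $\big(\int_0^\infty[t^{1/r}(\mathbf u\mathbf s)^*_\nu(t)]^\mu\frac{dt}t\big)^{1/\mu}$ (supremum if $\mu=\infty$), where $\mathbf u\mathbf s=\{u_Qs_Q\}$ and $\mathbf s^*_\nu(t)=\inf\{\lambda>0:\nu(\{Q:|s_Q|>\lambda\})\le t\}$. $(\mathbb X,\mathbb Y)_{\theta,q}$ is the set of $f\in\mathbb X+\mathbb Y$ with $\big(\int_0^\infty[t^{-\theta}K(f,t)]^q\frac{dt}t\big)^{1/q}<\infty$ (supremum if $q=\infty$), where $K(f,t)=\inf_{f=h+g}\{\|h\|_{\mathbb X}+t\|g\|_{\mathbb Y}\}$. Equality of spaces means the same elements and equivalent quasi-norms. **Theorem.** Let $s_1,s_2\in\mathbb R$, $0<p_1<\infty$, $0<p_2\le\infty$, $\alpha=p_1\big(s_2-\frac1{p_2}-s_1+\frac1{p_1}\big)$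 and $u_Q=|Q|^{-s_2+\frac1{p_2}-\frac12}$. Let $\xi_0,\xi_1\in(0,\infty)$ and $1/r_i=\xi_i+1/p_1$, $i=0,1$. For $\theta\in(0,1)$ put $\xi=(1-\theta)\xi_0+\theta\xi_1$ and $1/r=(1-\theta)/r_0+\theta/r_1$; then $1/r=\xi+1/p_1$. i) If $\xi_0\ne\xi_1$, then for all $\mu_0,\mu_1,\mu\in(0,\infty]$ and $\theta\in(0,1)$ $$\big(\mathcal A^{\xi_0}_{\mu_0}(\mathbf b^{s_1,p_1}_{p_1}(AB),\nu_\alpha),\mathcal A^{\xi_1}_{\mu_1}(\mathbf b^{s_1,p_1}_{p_1}(AB),\nu_\alpha)\big)_{\theta,\mu}=\mathcal A^{\xi}_{\mu}(\mathbf b^{s_1,p_1}_{p_1}(AB),\nu_\alpha)$$ and $$\big(\ell^{r_0,\mu_0}(\mathbf u,\nu_\alpha),\ell^{r_1,\mu_1}(\mathbf u,\nu_\alpha)\big)_{\theta,\mu}=\ell^{r,\mu}(\mathbf u,\nu_\alpha).$$ ii) Let $\gamma_i=s_1+\xi_i(1-\alpha)$, $i=0,1$, and $\gamma=(1-\theta)\gamma_0+\theta\gamma_1$,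 which equals $s_1+\xi(1-\alpha)$. Then for all $\theta\in(0,1)$ $$\big(\mathbf b^{\gamma_0,r_0}_{r_0}(AB),\mathbf b^{\gamma_1,r_1}_{r_1}(AB)\big)_{\theta,r}=\mathbf b^{\gamma,r}_r(AB).$$ -/

import Mathlib

open MeasureTheory Set
open scoped ENNReal NNReal Matrix

/-! ### Restricted nonlinear approximation, Lorentz and interpolation spaces of sequences

`S = (D → ℂ)` is the space of all complex sequences on a countable index set `D`.  A quasi-normed
sequence space is given by its quasi-norm `N : (D → ℂ) → ℝ≥0∞` on all of `S` (value `∞` outside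
the space); the space itself is `{s | N s < ∞}`. -/

namespace Shearlet

noncomputable section

/-- The `ℓ^p` quasi-norm of a family of nonnegative (possibly infinite) numbers, `0 < p ≤ ∞`. -/
def ellNorm {ι : Type} (p : ℝ≥0∞) (a : ι → ℝ≥0∞) : ℝ≥0∞ :=
  if p = ∞ then ⨆ i, a i else (∑' i, a i ^ p.toReal) ^ (1 / p.toReal)

/-- `(∫₀^∞ φ(t)^q dt/t)^{1/q}` for `0 < q < ∞`, and `sup_{t>0} φ(t)` for `q = ∞`. -/
def haarNorm (q : ℝ≥0∞) (φ : ℝ → ℝ≥0∞) : ℝ≥0∞ :=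
  if q = ∞ then ⨆ t ∈ Ioi (0 : ℝ), φ t
  else (∫⁻ t in Ioi (0 : ℝ), φ t ^ q.toReal / ENNReal.ofReal t) ^ (1 / q.toReal)

section Sequences

variable {D : Type}

/-- `ν(Γ) = ∑_{I ∈ Γ} ν(I)`. -/
def meas (ν : D → ℝ≥0∞) (Γ : Set D) : ℝ≥0∞ := ∑' I : Γ, ν I

/-- `Σ_{t,ν}`: the sequences that vanish outside some `Γ` with `ν(Γ) ≤ t`. -/
def Sig (ν : D → ℝ≥0∞) (t : ℝ) : Set (D → ℂ) :=
  {g | ∃ Γ : Set D, meas ν Γ ≤ ENNReal.ofReal t ∧ ∀ I, I ∉ Γ → g I = 0}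

/-- The error of approximation `σ_ν(t, s)` of `s` by elements of `Σ_{t,ν}`, measured in `N`. -/
def approxError (N : (D → ℂ) → ℝ≥0∞) (ν : D → ℝ≥0∞) (t : ℝ) (s : D → ℂ) : ℝ≥0∞ :=
  ⨅ g ∈ Sig ν t, N (s - g)

/-- The quasi-norm of the restricted approximation space `𝒜^ξ_μ(𝔣, ν)`, `𝔣` given by `N`. -/
def approxNorm (N : (D → ℂ) → ℝ≥0∞) (ν : D → ℝ≥0∞) (ξ : ℝ) (μ : ℝ≥0∞) (s : D → ℂ) : ℝ≥0∞ :=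
  haarNorm μ fun t => ENNReal.ofReal t ^ ξ * approxError N ν t s

/-- The non-increasing rearrangement `s*_ν(t) = inf {λ > 0 : ν {I : |s_I| > λ} ≤ t}`
(`∞` if there is no such `λ`). -/
def rearr (ν : D → ℝ≥0∞) (s : D → ℂ) (t : ℝ) : ℝ≥0∞ :=
  ⨅ (l : ℝ≥0) (_ : 0 < l ∧ meas ν {I | (l : ℝ≥0∞) < ‖s I‖ₑ} ≤ ENNReal.ofReal t), (l : ℝ≥0∞)

/-- The quasi-norm of the discrete Lorentz space `ℓ^{p,μ}(ν)`, `0 < p < ∞`, `0 < μ ≤ ∞`. -/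
def lorentzNorm (ν : D → ℝ≥0∞) (p : ℝ) (μ : ℝ≥0∞) (s : D → ℂ) : ℝ≥0∞ :=
  haarNorm μ fun t => ENNReal.ofReal t ^ (1 / p) * rearr ν s t

/-- The quasi-norm of the weighted discrete Lorentz space `ℓ^{p,μ}(u, ν)`. -/
def weightedLorentzNorm (u : D → ℝ) (ν : D → ℝ≥0∞) (p : ℝ) (μ : ℝ≥0∞) (s : D → ℂ) : ℝ≥0∞ :=
  lorentzNorm ν p μ fun I => (u I : ℂ) * s I

/-- Peetre's functional `K(s, t; 𝕏, 𝕐)`; it is finite (for `t > 0`) exactly when `s ∈ 𝕏 + 𝕐`. -/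
def peetreK (N₀ N₁ : (D → ℂ) → ℝ≥0∞) (t : ℝ) (s : D → ℂ) : ℝ≥0∞ :=
  ⨅ (h : D → ℂ) (g : D → ℂ) (_ : s = h + g), N₀ h + ENNReal.ofReal t * N₁ g

/-- The quasi-norm of the real interpolation space `(𝕏, 𝕐)_{θ,q}`, `0 < θ < 1`, `0 < q ≤ ∞`.
Its finiteness contains the condition `s ∈ 𝕏 + 𝕐`. -/
def interpNorm (N₀ N₁ : (D → ℂ) → ℝ≥0∞) (θ : ℝ) (q : ℝ≥0∞) (s : D → ℂ) : ℝ≥0∞ :=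
  haarNorm q fun t => ENNReal.ofReal t ^ (-θ) * peetreK N₀ N₁ t s

/-- Two quasi-normed sequence spaces coincide: they have the same elements and their quasi-norms
are equivalent. -/
def SameSpace (N N' : (D → ℂ) → ℝ≥0∞) : Prop :=
  {s | N s < ∞} = {s | N' s < ∞} ∧
    ∃ C : ℝ≥0, 0 < C ∧ ∀ s, N s < ∞ → N s ≤ C * N' s ∧ N' s ≤ C * N s

end Sequences

/-! ### Shearlet indices and anisotropic parallelepipeds -/

/-- `A_(i)`: the diagonal matrix with entry `4` at `i` and `2` elsewhere. -/
def dilation {d : ℕ} (i : Fin d) : Matrix (Fin d) (Fin d) ℝ :=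
  Matrix.diagonal fun a => if a = i then 4 else 2

/-- `B_(i)^[ℓ]`: ones on the diagonal, and the `d - 1` entries of `ℓ` in the rest of row `i`. -/
def shear {d : ℕ} (i : Fin d) (l : {b : Fin d // b ≠ i} → ℤ) : Matrix (Fin d) (Fin d) ℝ :=
  1 + Matrix.of fun a b => if h : a = i ∧ b ≠ i then (l ⟨b, h.2⟩ : ℝ) else 0

/-- The triples `(i, j, ℓ)`: direction `i`, scale `j ≥ 0`, and shear parameter `ℓ` with `d - 1`
integer components (labelled by the axes other than `i`), each of modulus at most `2^j`. -/
abbrev Family (d : ℕ) : Type :=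
  Σ i : Fin d, Σ j : ℕ, {b : Fin d // b ≠ i} → Icc (-(2 ^ j) : ℤ) (2 ^ j)

/-- The index set: the positions `k ∈ ℤ^d` of the coarse coefficients `s_k`, together with the
shearlet indices `(i, j, ℓ, k)`, i.e. the elements `Q` of `𝒬_AB`. -/
abbrev Index (d : ℕ) : Type := (Fin d → ℤ) ⊕ (Family d × (Fin d → ℤ))

/-- `Q₀ + k`, with `Q₀ = [0,1)^d`. -/
def unitCube {d : ℕ} (k : Fin d → ℤ) : Set (Fin d → ℝ) :=
  (fun x a => x a + (k a : ℝ)) '' (univ.pi fun _ => Ico (0 : ℝ) 1)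

/-- `Q_k = Q₀ + k` for a coarse index, and `Q = A_(i)^{-j} B_(i)^[-ℓ] (Q₀ + k)` for a shearlet
index. -/
def cube {d : ℕ} : Index d → Set (Fin d → ℝ)
  | Sum.inl k => unitCube k
  | Sum.inr (⟨i, j, l⟩, k) =>
      (fun x => ((dilation i ^ j)⁻¹ * shear i fun b => -(l b : ℤ)) *ᵥ x) '' unitCube k

/-- `|Q|`, the Lebesgue measure of `Q`. -/
def size {d : ℕ} (Q : Index d) : ℝ := volume.real (cube Q)

/-- The measure `ν_α` on the index set: `ν_α(Q) = |Q|^α`. -/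
def nu {d : ℕ} (α : ℝ) (Q : Index d) : ℝ≥0∞ := ENNReal.ofReal (size Q ^ α)

/-- The quasi-norm of the shear anisotropic inhomogeneous Besov sequence space `𝐛^{s,q}_p(AB)`,
`s ∈ ℝ`, `0 < p, q ≤ ∞` (the arguments are in the order `s q p`). -/
def besovNorm {d : ℕ} (s : ℝ) (q p : ℝ≥0∞) (a : Index d → ℂ) : ℝ≥0∞ :=
  ellNorm p (fun k : Fin d → ℤ => ‖a (Sum.inl k)‖ₑ) +
    ellNorm q fun F : Family d => ellNorm p fun k : Fin d → ℤ =>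
      ENNReal.ofReal (size (Sum.inr (F, k) : Index d) ^ (-s + (p⁻¹).toReal - 1 / 2)) *
        ‖a (Sum.inr (F, k))‖ₑ

theorem det_dilation {d : ℕ} (i : Fin d) : (dilation i).det = 2 ^ (d + 1) := by
  have h2 : ∀ a : Fin d, (if a = i then (4 : ℝ) else 2) = 2 * (if a = i then 2 else 1) := by
    intro a; split_ifs <;> norm_num
  simp only [dilation, Matrix.det_diagonal, h2, Finset.prod_mul_distrib]
  simp [pow_succ]

theorem det_shear {d : ℕ} (i : Fin d) (l : {b : Fin d // b ≠ i} → ℤ) : (shear i l).det = 1 := by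
  classical
  have h : shear i l = 1 + Matrix.replicateCol Unit (Pi.single i (1 : ℝ)) *
      Matrix.replicateRow Unit (fun b => if h : b ≠ i then (l ⟨b, h⟩ : ℝ) else 0) := by
    unfold shear
    congr 1
    ext a b
    by_cases ha : a = i <;> by_cases hb : b = i <;> simp [Matrix.mul_apply, ha, hb]
  rw [h, Matrix.det_one_add_replicateCol_mul_replicateRow]
  simp

theorem volume_unitCube {d : ℕ} (k : Fin d → ℤ) : volume (unitCube k) = 1 := by
  have h : unitCube k =
      (fun x : Fin d → ℝ => x + fun a => (k a : ℝ)) '' (univ.pi fun _ => Ico (0 : ℝ) 1) := rfl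
  rw [h, image_add_right, measure_preimage_add_right, Real.volume_pi_Ico]
  simp

theorem size_inl {d : ℕ} (k : Fin d → ℤ) : size (Sum.inl k : Index d) = 1 := by
  simp [size, cube, Measure.real, volume_unitCube]

/-- `|Q_{j,ℓ,k}| = 2^{-(d+1)j}`. -/
theorem size_inr {d : ℕ} (F : Family d) (k : Fin d → ℤ) :
    size (Sum.inr (F, k) : Index d) = ((2 : ℝ) ^ ((d + 1) * F.2.1))⁻¹ := by
  obtain ⟨i, j, l⟩ := F
  have h := Measure.addHaar_image_linearMap (volume : Measure (Fin d → ℝ))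
    (Matrix.toLin' ((dilation i ^ j)⁻¹ * shear i fun b => -(l b : ℤ))) (unitCube k)
  have hdet : ((dilation i ^ j)⁻¹ * shear i fun b => -(l b : ℤ)).det
      = ((2 : ℝ) ^ ((d + 1) * j))⁻¹ := by
    rw [Matrix.det_mul, det_shear, Matrix.det_nonsing_inv, Matrix.det_pow, det_dilation,
      Ring.inverse_eq_inv', mul_one, ← pow_mul]
  rw [LinearMap.det_toLin', hdet, volume_unitCube, mul_one, abs_of_nonneg (by positivity)] at h
  have h' : size (Sum.inr (⟨i, j, l⟩, k) : Index d) =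
      volume.real (⇑(Matrix.toLin' ((dilation i ^ j)⁻¹ * shear i fun b => -(l b : ℤ))) ''
        unitCube k) := rfl
  rw [h', Measure.real, h, ENNReal.toReal_ofReal (by positivity)]

end

end Shearlet

namespace Shearlet

/-! ### Discrete quasi-norms -/

/-! All three equalities rest on one fact, `interpNorm_approxNorm`: for a fixed quasi-norm `N` and a
fixed `ν`, the spaces `𝒜^ξ_μ(N, ν)` form a real interpolation scale in `ξ`, whatever the fine
indices. No Jackson or Bernstein inequality is needed, only the quasi-triangle inequality and `Σ_s +
Σ_t ⊆ Σ_{s+t}`. On dyadic scales, if `f = h + g`, half of the budget `2^n` goes to each summand, so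
the error of `f` at `2^n` is bounded by the K-functional. Conversely, a near-best approximant `g` of
`f` at level `2^n` splits `f` as `g + (f - g)`: `g` has no error beyond level `n` and inherits that
of `f` below it, while `f - g` inherits the error of `f` beyond `n`. The K-functional is then at
most a supremum of errors with geometric weights, and this maximal operator is bounded on `ℓ^μ`
(`exists_near_best_bounds`, `exists_ellNorm_decaySup_le`).

The first equality of i) is the case where `N` is the Besov quasi-norm. For the second, the
rearrangement of `u s` is the approximation error of `s` in weighted `ℓ^∞` (`rearr_eq_approxError`),
so weighted Lorentz spaces are themselves approximation spaces, with exponent `1/r`. For ii), the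
layer cake formula (`lintegral_rearr_rpow`) identifies `ℓ^{r,r}(u, ν)` with a weighted Lebesgue
space, and `γ` is the smoothness for which this is the Besov space (`besovNorm_equivalent`). When
`ξ₀ = ξ₁` both endpoint spaces coincide and `interpNorm_self` applies. -/

theorem two_rpow_mul (x y : ℝ) : (2 : ℝ≥0∞) ^ x * 2 ^ y = 2 ^ (x + y) :=
  (ENNReal.rpow_add x y (by norm_num) (by norm_num)).symm

theorem two_rpow_ne_top (x : ℝ) : (2 : ℝ≥0∞) ^ x ≠ ∞ := by
  simp [ENNReal.rpow_eq_top_iff]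

theorem two_rpow_ne_zero (x : ℝ) : (2 : ℝ≥0∞) ^ x ≠ 0 := by
  simp [ENNReal.rpow_eq_zero_iff]

theorem two_rpow_le {x y : ℝ} (h : x ≤ y) : (2 : ℝ≥0∞) ^ x ≤ 2 ^ y :=
  ENNReal.rpow_le_rpow_of_exponent_le (by norm_num) h

theorem ofReal_two_rpow (x : ℝ) : ENNReal.ofReal ((2 : ℝ) ^ x) = 2 ^ x := by
  rw [← ENNReal.ofReal_rpow_of_pos (by norm_num)]; norm_num

theorem toReal_pos_of_ne_top {p : ℝ≥0∞} (hp : 0 < p) (hp' : p ≠ ∞) : 0 < p.toReal :=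
  ENNReal.toReal_pos hp.ne' hp'

theorem ellNorm_mono {ι : Type} {p : ℝ≥0∞} {a b : ι → ℝ≥0∞} (h : ∀ i, a i ≤ b i) :
    ellNorm p a ≤ ellNorm p b := by
  unfold ellNorm
  split_ifs
  · exact iSup_mono h
  · gcongr with i
    exact h i

theorem ellNorm_const_mul {ι : Type} {p : ℝ≥0∞} (hp : 0 < p) (C : ℝ≥0∞) (a : ι → ℝ≥0∞) :
    ellNorm p (fun i => C * a i) = C * ellNorm p a := by
  unfold ellNorm
  split_ifs with h
  · rw [ENNReal.mul_iSup]
  · have hr := toReal_pos_of_ne_top hp h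
    simp_rw [ENNReal.mul_rpow_of_nonneg _ _ hr.le]
    rw [ENNReal.tsum_mul_left, ENNReal.mul_rpow_of_nonneg _ _ (by positivity),
      ← ENNReal.rpow_mul, mul_one_div_cancel hr.ne', ENNReal.rpow_one]

theorem ellNorm_le_const_mul {ι : Type} {p : ℝ≥0∞} (hp : 0 < p) {C : ℝ≥0∞} {a b : ι → ℝ≥0∞}
    (h : ∀ i, a i ≤ C * b i) : ellNorm p a ≤ C * ellNorm p b :=
  (ellNorm_mono h).trans_eq (ellNorm_const_mul hp C b)

theorem ellNorm_comp_equiv {ι κ : Type} (p : ℝ≥0∞) (e : ι ≃ κ) (a : κ → ℝ≥0∞) :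
    ellNorm p (fun i => a (e i)) = ellNorm p a := by
  unfold ellNorm
  rw [e.iSup_comp (g := a), e.tsum_eq (fun i => a i ^ p.toReal)]

theorem le_ellNorm {ι : Type} {p : ℝ≥0∞} (hp : 0 < p) (a : ι → ℝ≥0∞) (i : ι) :
    a i ≤ ellNorm p a := by
  unfold ellNorm
  split_ifs with h
  · exact le_iSup a i
  · have hr := toReal_pos_of_ne_top hp h
    calc a i = (a i ^ p.toReal) ^ (1 / p.toReal) := by
          rw [← ENNReal.rpow_mul, mul_one_div_cancel hr.ne', ENNReal.rpow_one]
      _ ≤ _ := by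
          gcongr
          exact ENNReal.le_tsum (f := fun i => a i ^ p.toReal) i

theorem tsum_two_rpow_ne_top {ε : ℝ} (hε : 0 < ε) (n : ℤ) :
    ∑' k : ℤ, (2 : ℝ≥0∞) ^ (-ε * |(k : ℝ) - n|) = ∑' k : ℤ, (2 : ℝ≥0∞) ^ (-ε * |(k : ℝ)|) ∧
      ∑' k : ℤ, (2 : ℝ≥0∞) ^ (-ε * |(k : ℝ)|) ≠ ∞ := by
  constructor
  · rw [← (Equiv.addRight n).tsum_eq]
    simp
  · have hs : Summable fun k : ℤ => (2 : ℝ) ^ (-ε * |(k : ℝ)|) := by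
      have hg : Summable fun k : ℕ => (2 : ℝ) ^ (-ε * (k : ℝ)) := by
        simp_rw [Real.rpow_mul (zero_le_two : (0 : ℝ) ≤ 2), Real.rpow_natCast]
        apply summable_geometric_of_lt_one (by positivity)
        exact Real.rpow_lt_one_of_one_lt_of_neg (by norm_num) (by linarith)
      apply Summable.of_nat_of_neg <;> simpa using hg
    have := hs.tsum_ofReal_ne_top
    simpa only [ofReal_two_rpow] using this

/-- A sequence decaying geometrically away from `n` has `ℓ^p` quasi-norm bounded uniformly in `n`. -/
theorem exists_ellNorm_le_of_decay {p : ℝ≥0∞} (hp : 0 < p) {ε : ℝ} (hε : 0 < ε) :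
    ∃ C : ℝ≥0, ∀ (n : ℤ) (S : ℝ≥0∞) (z : ℤ → ℝ≥0∞),
      (∀ k : ℤ, z k ≤ S * 2 ^ (-ε * |(k : ℝ) - n|)) → ellNorm p z ≤ C * S := by
  by_cases h : p = ∞
  · refine ⟨1, fun n S z hz => ?_⟩
    simp only [ellNorm, h, if_true]
    refine iSup_le fun k => (hz k).trans ?_
    rw [ENNReal.coe_one, one_mul]
    refine mul_le_of_le_one_right' ?_
    calc (2 : ℝ≥0∞) ^ (-ε * |(k : ℝ) - n|) ≤ 2 ^ (0 : ℝ) := two_rpow_le (by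
          have := mul_nonneg hε.le (abs_nonneg ((k : ℝ) - n)); linarith)
      _ = 1 := by simp
  · have hr := toReal_pos_of_ne_top hp h
    have hεr : 0 < ε * p.toReal := by positivity
    refine ⟨((∑' k : ℤ, (2 : ℝ≥0∞) ^ (-(ε * p.toReal) * |(k : ℝ)|)) ^ (1 / p.toReal)).toNNReal,
      fun n S z hz => ?_⟩
    rw [ENNReal.coe_toNNReal (ENNReal.rpow_ne_top_of_nonneg (by positivity)
      (tsum_two_rpow_ne_top hεr n).2), mul_comm]
    refine (ellNorm_le_const_mul hp hz).trans_eq ?_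
    simp only [ellNorm, h, if_false]
    rw [← (tsum_two_rpow_ne_top hεr n).1]
    congr 3
    ext k
    rw [← ENNReal.rpow_mul]
    ring_nf

/-- The discrete maximal operator with geometrically decaying weights. -/
noncomputable def decaySup (δ : ℝ) (y : ℤ → ℝ≥0∞) (n : ℤ) : ℝ≥0∞ :=
  ⨆ k : ℤ, y k * 2 ^ (-δ * |(k : ℝ) - n|)

/-- For finite `p`, the `p`-th power of a supremum is at most the sum of the `p`-th powers. After
exchanging the sums, every `k` carries the same convergent geometric series. Using a supremum
instead of a sum makes `p < 1` no harder than `p ≥ 1`. -/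
theorem exists_ellNorm_decaySup_le {p : ℝ≥0∞} (hp : 0 < p) {δ : ℝ} (hδ : 0 < δ) :
    ∃ C : ℝ≥0, ∀ y : ℤ → ℝ≥0∞, ellNorm p (decaySup δ y) ≤ C * ellNorm p y := by
  by_cases h : p = ∞
  · refine ⟨1, fun y => ?_⟩
    simp only [ellNorm, h, if_true]
    refine iSup_le fun n => iSup_le fun k => ?_
    rw [ENNReal.coe_one, one_mul]
    refine (mul_le_of_le_one_right' ?_).trans (le_iSup y k)
    calc (2 : ℝ≥0∞) ^ (-δ * |(k : ℝ) - n|) ≤ 2 ^ (0 : ℝ) := two_rpow_le (by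
          have := mul_nonneg hδ.le (abs_nonneg ((k : ℝ) - n)); linarith)
      _ = 1 := by simp
  · have hr := toReal_pos_of_ne_top hp h
    have hδr : 0 < δ * p.toReal := by positivity
    refine ⟨((∑' k : ℤ, (2 : ℝ≥0∞) ^ (-(δ * p.toReal) * |(k : ℝ)|)) ^ (1 / p.toReal)).toNNReal,
      fun y => ?_⟩
    rw [ENNReal.coe_toNNReal (ENNReal.rpow_ne_top_of_nonneg (by positivity)
      (tsum_two_rpow_ne_top hδr 0).2)]
    simp only [ellNorm, h, if_false]
    rw [← ENNReal.mul_rpow_of_nonneg _ _ (by positivity)]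
    gcongr
    have key : ∀ n, decaySup δ y n ^ p.toReal ≤
        ∑' k : ℤ, y k ^ p.toReal * 2 ^ (-(δ * p.toReal) * |(n : ℝ) - k|) := by
      intro n
      rw [← ENNReal.le_rpow_inv_iff hr]
      refine iSup_le fun k => ?_
      rw [ENNReal.le_rpow_inv_iff hr]
      refine le_trans (le_of_eq ?_) (ENNReal.le_tsum k)
      rw [ENNReal.mul_rpow_of_nonneg _ _ hr.le, ← ENNReal.rpow_mul, abs_sub_comm]
      ring_nf
    calc ∑' n, decaySup δ y n ^ p.toReal
        ≤ ∑' n : ℤ, ∑' k : ℤ, y k ^ p.toReal * 2 ^ (-(δ * p.toReal) * |(n : ℝ) - k|) :=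
          ENNReal.tsum_le_tsum key
      _ = ∑' k : ℤ, ∑' n : ℤ, y k ^ p.toReal * 2 ^ (-(δ * p.toReal) * |(n : ℝ) - k|) :=
          ENNReal.tsum_comm
      _ = _ := by
          simp_rw [ENNReal.tsum_mul_left, (tsum_two_rpow_ne_top hδr _).1]
          rw [ENNReal.tsum_mul_right, mul_comm]

theorem add_rpow_le_two_rpow_mul {r : ℝ} (hr : 0 < r) (a b : ℝ≥0∞) :
    (a + b) ^ r ≤ 2 ^ r * (a ^ r + b ^ r) := by
  calc (a + b) ^ r ≤ (2 * max a b) ^ r := by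
        gcongr
        rw [two_mul]
        exact add_le_add (le_max_left _ _) (le_max_right _ _)
    _ = 2 ^ r * (max a b) ^ r := ENNReal.mul_rpow_of_nonneg _ _ hr.le
    _ ≤ _ := by
        gcongr
        rcases le_total a b with h | h <;> simp [h]

theorem exists_ellNorm_add_le {ι : Type} {p : ℝ≥0∞} (hp : 0 < p) :
    ∃ C : ℝ≥0, ∀ a b : ι → ℝ≥0∞,
      ellNorm p (fun i => a i + b i) ≤ C * (ellNorm p a + ellNorm p b) := by
  by_cases h : p = ∞
  · refine ⟨1, fun a b => ?_⟩
    simp only [ellNorm, h, if_true, ENNReal.coe_one, one_mul]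
    exact iSup_le fun i => add_le_add (le_iSup a i) (le_iSup b i)
  · have hr := toReal_pos_of_ne_top hp h
    refine ⟨(2 * 2 ^ (1 / p.toReal) : ℝ≥0), fun a b => ?_⟩
    simp only [ellNorm, h, if_false]
    calc (∑' i, (a i + b i) ^ p.toReal) ^ (1 / p.toReal)
        ≤ (∑' i, 2 ^ p.toReal * (a i ^ p.toReal + b i ^ p.toReal)) ^ (1 / p.toReal) := by
          gcongr with i
          exact add_rpow_le_two_rpow_mul hr _ _
      _ = 2 * (∑' i, a i ^ p.toReal + ∑' i, b i ^ p.toReal) ^ (1 / p.toReal) := by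
          rw [ENNReal.tsum_mul_left, ENNReal.tsum_add,
            ENNReal.mul_rpow_of_nonneg _ _ (by positivity), ← ENNReal.rpow_mul,
            mul_one_div_cancel hr.ne', ENNReal.rpow_one]
      _ ≤ 2 * (2 ^ (1 / p.toReal) * ((∑' i, a i ^ p.toReal) ^ (1 / p.toReal) +
            (∑' i, b i ^ p.toReal) ^ (1 / p.toReal))) := by
          gcongr
          exact add_rpow_le_two_rpow_mul (by positivity) _ _
      _ = _ := by
          rw [ENNReal.coe_mul, ENNReal.coe_rpow_of_nonneg _ (by positivity), mul_assoc]
          rfl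

/-! ### Discretization of integrals with respect to the Haar measure `dt/t` -/

theorem exists_mem_Ico_two_rpow {lam : ℝ} (hl : 0 < lam) {t : ℝ} (ht : 0 < t) :
    ∃ n : ℤ, t ∈ Ico ((2 : ℝ) ^ (n * lam)) (2 ^ (((n + 1 : ℤ) : ℝ) * lam)) := by
  have h1 : (1 : ℝ) < 2 ^ lam := Real.one_lt_rpow (by norm_num) hl
  obtain ⟨n, hn⟩ := exists_mem_Ico_zpow ht h1
  refine ⟨n, ?_⟩
  have : ∀ m : ℤ, (2 : ℝ) ^ ((m : ℝ) * lam) = (2 ^ lam) ^ m := by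
    intro m
    rw [mul_comm, Real.rpow_mul (by norm_num), Real.rpow_intCast]
  rw [this, this]
  exact hn

theorem iUnion_Ico_two_rpow {lam : ℝ} (hl : 0 < lam) :
    ⋃ n : ℤ, Ico ((2 : ℝ) ^ (n * lam)) (2 ^ (((n + 1 : ℤ) : ℝ) * lam)) = Ioi 0 := by
  ext t
  simp only [mem_iUnion]
  constructor
  · rintro ⟨n, hn⟩
    exact lt_of_lt_of_le (Real.rpow_pos_of_pos (by norm_num) _) hn.1
  · exact exists_mem_Ico_two_rpow hl

theorem pairwise_disjoint_Ico_two_rpow {lam : ℝ} (hl : 0 < lam) :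
    Pairwise (Function.onFun Disjoint
      fun n : ℤ => Ico ((2 : ℝ) ^ (n * lam)) (2 ^ (((n + 1 : ℤ) : ℝ) * lam))) := by
  have hm : Monotone fun n : ℤ => (2 : ℝ) ^ ((n : ℝ) * lam) := by
    intro a b hab
    apply Real.rpow_le_rpow_of_exponent_le (by norm_num)
    have : (a : ℝ) ≤ b := by exact_mod_cast hab
    gcongr
  have := hm.pairwise_disjoint_on_Ico_succ
  simpa [Order.succ_eq_add_one] using this

theorem setLIntegral_Ioi_eq_tsum {lam : ℝ} (hl : 0 < lam) (f : ℝ → ℝ≥0∞) :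
    ∫⁻ t in Ioi (0 : ℝ), f t =
      ∑' n : ℤ, ∫⁻ t in Ico ((2 : ℝ) ^ (n * lam)) (2 ^ (((n + 1 : ℤ) : ℝ) * lam)), f t := by
  rw [← iUnion_Ico_two_rpow hl, lintegral_iUnion (fun _ => measurableSet_Ico)
    (pairwise_disjoint_Ico_two_rpow hl)]

theorem volume_Ico_two_rpow (lam : ℝ) (n : ℤ) :
    volume (Ico ((2 : ℝ) ^ (n * lam)) (2 ^ (((n + 1 : ℤ) : ℝ) * lam))) =
      2 ^ (n * lam) * ENNReal.ofReal (2 ^ lam - 1) := by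
  rw [Real.volume_Ico, ← ofReal_two_rpow, ← ENNReal.ofReal_mul (by positivity)]
  congr 1
  push_cast
  rw [add_mul, one_mul, Real.rpow_add (by norm_num)]
  ring

/-- Each cell has `dt/t`-mass at most `2^lam - 1`, independently of `n`. Since `F` is only compared
with constants on cells, it need not be measurable. -/
theorem exists_haarNorm_le_ellNorm {lam : ℝ} (hl : 0 < lam) {q : ℝ≥0∞} (hq : 0 < q) :
    ∃ C : ℝ≥0, ∀ (F : ℝ → ℝ≥0∞) (y : ℤ → ℝ≥0∞),
      (∀ n : ℤ, ∀ t ∈ Ico ((2 : ℝ) ^ (n * lam)) (2 ^ (((n + 1 : ℤ) : ℝ) * lam)), F t ≤ y n) →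
        haarNorm q F ≤ C * ellNorm q y := by
  by_cases h : q = ∞
  · refine ⟨1, fun F y hy => ?_⟩
    simp only [ellNorm, haarNorm, h, if_true, ENNReal.coe_one, one_mul]
    refine iSup₂_le fun t ht => ?_
    obtain ⟨n, hn⟩ := exists_mem_Ico_two_rpow hl ht
    exact (hy n t hn).trans (le_iSup y n)
  · have hr := toReal_pos_of_ne_top hq h
    refine ⟨(ENNReal.ofReal (2 ^ lam - 1) ^ (1 / q.toReal)).toNNReal, fun F y hy => ?_⟩
    rw [ENNReal.coe_toNNReal (by simp [ENNReal.rpow_eq_top_iff, hr.le])]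
    simp only [ellNorm, haarNorm, h, if_false]
    rw [← ENNReal.mul_rpow_of_nonneg _ _ (by positivity), setLIntegral_Ioi_eq_tsum hl,
      ← ENNReal.tsum_mul_left]
    gcongr with n
    calc ∫⁻ t in Ico ((2 : ℝ) ^ (n * lam)) (2 ^ (((n + 1 : ℤ) : ℝ) * lam)),
          F t ^ q.toReal / ENNReal.ofReal t
        ≤ ∫⁻ t in Ico ((2 : ℝ) ^ (n * lam)) (2 ^ (((n + 1 : ℤ) : ℝ) * lam)),
          y n ^ q.toReal * 2 ^ (-(n * lam)) := by
          refine setLIntegral_mono' measurableSet_Ico fun t ht => ?_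
          rw [div_eq_mul_inv, ENNReal.rpow_neg, ← ofReal_two_rpow]
          gcongr
          · exact hy n t ht
          · exact ht.1
      _ = _ := by
          rw [setLIntegral_const, volume_Ico_two_rpow, mul_assoc, ← mul_assoc (2 ^ _),
            two_rpow_mul, neg_add_cancel, ENNReal.rpow_zero, one_mul, mul_comm]

theorem exists_ellNorm_le_haarNorm {lam : ℝ} (hl : 0 < lam) {q : ℝ≥0∞} (hq : 0 < q) :
    ∃ C : ℝ≥0, ∀ (F : ℝ → ℝ≥0∞) (y : ℤ → ℝ≥0∞),
      (∀ n : ℤ, ∀ t ∈ Ico ((2 : ℝ) ^ (n * lam)) (2 ^ (((n + 1 : ℤ) : ℝ) * lam)), y n ≤ F t) →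
        ellNorm q y ≤ C * haarNorm q F := by
  have hlt : ∀ n : ℤ, (2 : ℝ) ^ (n * lam) < 2 ^ (((n + 1 : ℤ) : ℝ) * lam) := by
    intro n
    apply Real.rpow_lt_rpow_of_exponent_lt (by norm_num)
    push_cast
    linarith
  by_cases h : q = ∞
  · refine ⟨1, fun F y hy => ?_⟩
    simp only [ellNorm, haarNorm, h, if_true, ENNReal.coe_one, one_mul]
    refine iSup_le fun n => ?_
    exact (hy n _ ⟨le_rfl, hlt n⟩).trans
      (le_iSup₂ (f := fun t (_ : t ∈ Ioi (0 : ℝ)) => F t) _ (Real.rpow_pos_of_pos two_pos _))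
  · have hr := toReal_pos_of_ne_top hq h
    -- A lower bound for the `dt/t`-mass of every cell: its length divided by its right endpoint.
    set c : ℝ≥0∞ := 2 ^ (-lam) * ENNReal.ofReal (2 ^ lam - 1) with hc
    have h1 : (1 : ℝ) < 2 ^ lam := Real.one_lt_rpow (by norm_num) hl
    have hc0 : c ≠ 0 := mul_ne_zero (two_rpow_ne_zero _) (by simpa using h1)
    have hct : c ≠ ∞ := ENNReal.mul_ne_top (two_rpow_ne_top _) ENNReal.ofReal_ne_top
    refine ⟨((c⁻¹) ^ (1 / q.toReal)).toNNReal, fun F y hy => ?_⟩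
    rw [ENNReal.coe_toNNReal (ENNReal.rpow_ne_top_of_nonneg (by positivity) (by simpa using hc0))]
    simp only [ellNorm, haarNorm, h, if_false]
    rw [← ENNReal.mul_rpow_of_nonneg _ _ (by positivity), setLIntegral_Ioi_eq_tsum hl,
      ← ENNReal.tsum_mul_left]
    gcongr with n
    calc y n ^ q.toReal = c⁻¹ * (y n ^ q.toReal * c) := by
          rw [mul_comm, mul_assoc, ENNReal.mul_inv_cancel hc0 hct, mul_one]
      _ = c⁻¹ * ∫⁻ t in Ico ((2 : ℝ) ^ (n * lam)) (2 ^ (((n + 1 : ℤ) : ℝ) * lam)),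
          y n ^ q.toReal * 2 ^ (-(((n + 1 : ℤ) : ℝ) * lam)) := by
          rw [setLIntegral_const, volume_Ico_two_rpow, mul_assoc, ← mul_assoc (2 ^ _),
            two_rpow_mul, hc]
          push_cast
          ring_nf
      _ ≤ _ := by
          refine mul_le_mul' le_rfl ?_
          refine setLIntegral_mono' measurableSet_Ico fun t ht => ?_
          rw [div_eq_mul_inv, ENNReal.rpow_neg, ← ofReal_two_rpow]
          gcongr
          · exact hy n t ht
          · exact ht.2.le

/-! ### Quasi-norms up to equivalence -/

theorem le_mul_of_forall_gt {x S C : ℝ≥0∞} (hC : 1 ≤ C) (hC' : C ≠ ∞)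
    (h : ∀ S' > S, x ≤ C * S') : x ≤ C * S :=
  ENNReal.le_mul_of_forall_lt (Or.inl (by positivity)) (Or.inl hC') fun a' ha b' hb =>
    (h b' hb).trans (by gcongr)

theorem le_mul_add_of_forall_gt {x a b C : ℝ≥0∞} (hC : 1 ≤ C) (hC' : C ≠ ∞)
    (h : ∀ a' > a, ∀ b' > b, x ≤ C * (a' + b')) : x ≤ C * (a + b) := by
  have hC0 : C ≠ 0 := by positivity
  -- An infinite `a` or `b` has nothing strictly above it, so the hypothesis is empty there.
  rcases eq_or_ne a ∞ with rfl | ha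
  · simp [hC0]
  rcases eq_or_ne b ∞ with rfl | hb
  · simp [hC0]
  have ht : Filter.Tendsto (fun ε : ℝ≥0∞ => C * ((a + ε) + (b + ε))) (nhdsWithin 0 (Ioi 0))
      (nhds (C * (a + b))) := by
    have hcont : Continuous fun ε : ℝ≥0∞ => C * ((a + ε) + (b + ε)) :=
      (ENNReal.continuous_const_mul hC').comp (by fun_prop)
    have := (hcont.tendsto 0).mono_left (nhdsWithin_le_nhds (s := Ioi 0))
    simpa using this
  refine ge_of_tendsto ht ?_
  filter_upwards [self_mem_nhdsWithin] with ε hε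
  exact h _ (ENNReal.lt_add_right ha (ne_of_gt hε)) _ (ENNReal.lt_add_right hb (ne_of_gt hε))

/-- `F ≤ C G` with a finite constant `C`. -/
def Dominated {X : Type} (F G : X → ℝ≥0∞) : Prop := ∃ C : ℝ≥0, ∀ x, F x ≤ C * G x

theorem Dominated.trans {X : Type} {F G H : X → ℝ≥0∞} (h₁ : Dominated F G)
    (h₂ : Dominated G H) : Dominated F H := by
  obtain ⟨C, hC⟩ := h₁
  obtain ⟨C', hC'⟩ := h₂
  refine ⟨C * C', fun x => (hC x).trans ?_⟩
  rw [ENNReal.coe_mul, mul_assoc]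
  gcongr
  exact hC' x

theorem Dominated.one_le {X : Type} {F G : X → ℝ≥0∞} (h : Dominated F G) :
    ∃ C : ℝ≥0, 1 ≤ C ∧ ∀ x, F x ≤ C * G x := by
  obtain ⟨C, hC⟩ := h
  refine ⟨C + 1, le_add_self, fun x => (hC x).trans ?_⟩
  gcongr
  exact_mod_cast le_self_add

variable {D : Type}

theorem sameSpace_of_dominated {N N' : (D → ℂ) → ℝ≥0∞} (h : Dominated N N')
    (h' : Dominated N' N) : SameSpace N N' := by
  obtain ⟨C, hC1, hC⟩ := h.one_le
  obtain ⟨C', hC1', hC'⟩ := h'.one_le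
  refine ⟨?_, C * C', by positivity, fun s _ => ⟨(hC s).trans ?_, (hC' s).trans ?_⟩⟩
  · ext s
    exact ⟨fun hs => (hC' s).trans_lt (ENNReal.mul_lt_top (by simp) hs),
      fun hs => (hC s).trans_lt (ENNReal.mul_lt_top (by simp) hs)⟩
  · gcongr
    exact_mod_cast le_mul_of_one_le_right' hC1'
  · gcongr
    exact_mod_cast le_mul_of_one_le_left' hC1

/-- The properties of a quasi-norm that are used for approximation spaces. -/
structure IsQuasiNorm (N : (D → ℂ) → ℝ≥0∞) : Prop where
  zero : N 0 = 0
  neg : ∀ f, N (-f) = N f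
  add : ∃ C : ℝ≥0, 1 ≤ C ∧ ∀ f g, N (f + g) ≤ C * (N f + N g)

theorem haarNorm_mono {q : ℝ≥0∞} {φ ψ : ℝ → ℝ≥0∞} (h : ∀ t, 0 < t → φ t ≤ ψ t) :
    haarNorm q φ ≤ haarNorm q ψ := by
  unfold haarNorm
  split_ifs
  · exact iSup₂_mono h
  · refine ENNReal.rpow_le_rpow (setLIntegral_mono' measurableSet_Ioi fun t ht => ?_)
      (by positivity)
    gcongr
    exact h t ht

/-- Finiteness of `C` is what lets it leave the integral of a possibly non-measurable `φ`. -/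
theorem haarNorm_const_mul {q : ℝ≥0∞} (hq : 0 < q) (C : ℝ≥0) (φ : ℝ → ℝ≥0∞) :
    haarNorm q (fun t => C * φ t) = C * haarNorm q φ := by
  unfold haarNorm
  split_ifs with h
  · simp_rw [ENNReal.mul_iSup]
  · have hr := toReal_pos_of_ne_top hq h
    simp_rw [ENNReal.mul_rpow_of_nonneg _ _ hr.le, mul_div_assoc]
    rw [lintegral_const_mul' _ _ (ENNReal.rpow_ne_top_of_nonneg hr.le ENNReal.coe_ne_top),
      ENNReal.mul_rpow_of_nonneg _ _ (by positivity),
      ← ENNReal.rpow_mul, mul_one_div_cancel hr.ne', ENNReal.rpow_one]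

theorem dominated_haarNorm {X : Type} {q : ℝ≥0∞} (hq : 0 < q) {φ ψ : X → ℝ → ℝ≥0∞}
    (h : ∃ C : ℝ≥0, ∀ x t, 0 < t → φ x t ≤ C * ψ x t) :
    Dominated (fun x => haarNorm q (φ x)) (fun x => haarNorm q (ψ x)) := by
  obtain ⟨C, hC⟩ := h
  exact ⟨C, fun x => (haarNorm_mono (hC x)).trans_eq (haarNorm_const_mul hq C _)⟩

theorem peetreK_le {N₀ N₁ : (D → ℂ) → ℝ≥0∞} (t : ℝ) {s h g : D → ℂ} (e : s = h + g) :
    peetreK N₀ N₁ t s ≤ N₀ h + ENNReal.ofReal t * N₁ g :=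
  iInf_le_of_le h (iInf_le_of_le g (iInf_le_of_le e le_rfl))

theorem peetreK_mono (N₀ N₁ : (D → ℂ) → ℝ≥0∞) {t t' : ℝ} (h : t ≤ t') (s : D → ℂ) :
    peetreK N₀ N₁ t s ≤ peetreK N₀ N₁ t' s := by
  unfold peetreK
  gcongr

theorem dominated_interpNorm {N₀ N₁ M₀ M₁ : (D → ℂ) → ℝ≥0∞} {θ : ℝ} {q : ℝ≥0∞} (hq : 0 < q)
    (h₀ : Dominated N₀ M₀) (h₁ : Dominated N₁ M₁) :
    Dominated (interpNorm N₀ N₁ θ q) (interpNorm M₀ M₁ θ q) := by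
  obtain ⟨C, hC1, hC⟩ := h₀.one_le
  obtain ⟨C', hC1', hC'⟩ := h₁.one_le
  refine dominated_haarNorm hq ⟨C + C', fun s t ht => ?_⟩
  rw [mul_left_comm]
  gcongr
  unfold peetreK
  have h0 : ((C + C' : ℝ≥0) : ℝ≥0∞) ≠ 0 := by positivity
  simp_rw [ENNReal.mul_iInf_of_ne h0 ENNReal.coe_ne_top]
  refine iInf_mono fun h => iInf_mono fun g => iInf_mono fun e => ?_
  rw [mul_add, mul_left_comm]
  gcongr
  · refine (hC h).trans ?_
    gcongr
    exact_mod_cast le_self_add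
  · refine (hC' g).trans ?_
    gcongr
    exact_mod_cast le_add_self

/-! ### Errors of approximation -/

theorem meas_mono (ν : D → ℝ≥0∞) {Γ Γ' : Set D} (h : Γ ⊆ Γ') : meas ν Γ ≤ meas ν Γ' :=
  ENNReal.tsum_mono_subtype ν h

theorem Sig_mono (ν : D → ℝ≥0∞) {s t : ℝ} (h : s ≤ t) : Sig ν s ⊆ Sig ν t := by
  rintro g ⟨Γ, hΓ, hg⟩
  exact ⟨Γ, hΓ.trans (ENNReal.ofReal_le_ofReal h), hg⟩

theorem zero_mem_Sig (ν : D → ℝ≥0∞) (t : ℝ) : (0 : D → ℂ) ∈ Sig ν t :=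
  ⟨∅, by simp [meas], fun _ _ => rfl⟩

/-- The sets `Σ_t` are not linear, but budgets add up under union of supports. Nonnegativity matters
because `ENNReal.ofReal` truncates negative budgets to zero. -/
theorem add_mem_Sig {ν : D → ℝ≥0∞} {s t : ℝ} (hs : 0 ≤ s) (ht : 0 ≤ t) {g h : D → ℂ}
    (hg : g ∈ Sig ν s) (hh : h ∈ Sig ν t) : g + h ∈ Sig ν (s + t) := by
  obtain ⟨Γ, hΓ, hg⟩ := hg
  obtain ⟨Δ, hΔ, hh⟩ := hh
  refine ⟨Γ ∪ Δ, ?_, fun I hI => ?_⟩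
  · rw [ENNReal.ofReal_add hs ht]
    exact (ENNReal.tsum_union_le ν Γ Δ).trans (add_le_add hΓ hΔ)
  · simp only [mem_union, not_or] at hI
    simp [hg I hI.1, hh I hI.2]

theorem approxError_le {N : (D → ℂ) → ℝ≥0∞} {ν : D → ℝ≥0∞} {t : ℝ} (s : D → ℂ) {g : D → ℂ}
    (hg : g ∈ Sig ν t) : approxError N ν t s ≤ N (s - g) :=
  iInf₂_le g hg

theorem approxError_le_self (N : (D → ℂ) → ℝ≥0∞) (ν : D → ℝ≥0∞) (t : ℝ) (s : D → ℂ) :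
    approxError N ν t s ≤ N s := by
  simpa using approxError_le (N := N) s (zero_mem_Sig ν t)

theorem approxError_anti (N : (D → ℂ) → ℝ≥0∞) (ν : D → ℝ≥0∞) {t t' : ℝ} (h : t ≤ t')
    (s : D → ℂ) : approxError N ν t' s ≤ approxError N ν t s :=
  le_iInf₂ fun _ hg => approxError_le s (Sig_mono ν h hg)

theorem exists_mem_Sig_of_approxError_lt {N : (D → ℂ) → ℝ≥0∞} {ν : D → ℝ≥0∞} {t : ℝ}
    {s : D → ℂ} {M : ℝ≥0∞} (h : approxError N ν t s < M) : ∃ g ∈ Sig ν t, N (s - g) < M := by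
  simpa [approxError, iInf_lt_iff] using h

theorem approxError_eq_zero {N : (D → ℂ) → ℝ≥0∞} (h0 : N 0 = 0) {ν : D → ℝ≥0∞} {t : ℝ}
    {g : D → ℂ} (hg : g ∈ Sig ν t) : approxError N ν t g = 0 := by
  have := approxError_le (N := N) g hg
  simpa [h0] using this

theorem approxError_add_le {N : (D → ℂ) → ℝ≥0∞} {C : ℝ≥0} (hC1 : 1 ≤ C)
    (hC : ∀ f g, N (f + g) ≤ C * (N f + N g)) (ν : D → ℝ≥0∞) {s t : ℝ} (hs : 0 ≤ s)
    (ht : 0 ≤ t) (f g : D → ℂ) :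
    approxError N ν (s + t) (f + g) ≤ C * (approxError N ν s f + approxError N ν t g) := by
  refine le_mul_add_of_forall_gt (by exact_mod_cast hC1) ENNReal.coe_ne_top fun a ha b hb => ?_
  obtain ⟨h, hh, hhN⟩ := exists_mem_Sig_of_approxError_lt ha
  obtain ⟨k, hk, hkN⟩ := exists_mem_Sig_of_approxError_lt hb
  calc approxError N ν (s + t) (f + g) ≤ N (f + g - (h + k)) :=
        approxError_le _ (add_mem_Sig hs ht hh hk)
    _ = N ((f - h) + (g - k)) := by rw [add_sub_add_comm]
    _ ≤ _ := (hC _ _).trans (by gcongr)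

/-- An approximant of `f` is reused for `g`, so the budget `t` does not grow. -/
theorem approxError_le_of_close {N : (D → ℂ) → ℝ≥0∞} (hneg : ∀ f, N (-f) = N f) {C : ℝ≥0}
    (hC1 : 1 ≤ C) (hC : ∀ f g, N (f + g) ≤ C * (N f + N g)) (ν : D → ℝ≥0∞) (t : ℝ)
    (f g : D → ℂ) : approxError N ν t g ≤ C * (N (f - g) + approxError N ν t f) := by
  refine le_mul_add_of_forall_gt (by exact_mod_cast hC1) ENNReal.coe_ne_top fun a ha b hb => ?_
  obtain ⟨k, hk, hkN⟩ := exists_mem_Sig_of_approxError_lt hb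
  calc approxError N ν t g ≤ N (g - k) := approxError_le _ hk
    _ = N (-(f - g) + (f - k)) := by congr 1; abel
    _ ≤ C * (N (f - g) + N (f - k)) := by
        have := hC (-(f - g)) (f - k)
        rwa [hneg] at this
    _ ≤ _ := by gcongr

theorem neg_mem_Sig {ν : D → ℝ≥0∞} {t : ℝ} {g : D → ℂ} (hg : g ∈ Sig ν t) : -g ∈ Sig ν t := by
  obtain ⟨Γ, hΓ, h⟩ := hg
  exact ⟨Γ, hΓ, fun I hI => by simp [h I hI]⟩

/-! ### Discretized approximation and interpolation quasi-norms -/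

/-- The quasi-norm of an approximation space computed on the dyadic scale. -/
noncomputable def dyadicApproxNorm (N : (D → ℂ) → ℝ≥0∞) (ν : D → ℝ≥0∞) (a : ℝ) (μ : ℝ≥0∞)
    (s : D → ℂ) : ℝ≥0∞ :=
  ellNorm μ fun n : ℤ => 2 ^ (n * a) * approxError N ν (2 ^ (n : ℝ)) s

/-- The quasi-norm of an interpolation space computed on the scale `2 ^ (n * lam)`. -/
noncomputable def dyadicInterpNorm (N₀ N₁ : (D → ℂ) → ℝ≥0∞) (lam θ : ℝ) (q : ℝ≥0∞)
    (s : D → ℂ) : ℝ≥0∞ :=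
  ellNorm q fun n : ℤ => 2 ^ (-(n * (θ * lam))) * peetreK N₀ N₁ (2 ^ (n * lam)) s

/-- The error decreases in `t`, so on a dyadic cell its left-endpoint value bounds it, while `t^a`
varies by a factor at most `2^a`. The reverse estimate uses the right endpoint and a shift of `n`.
-/
theorem approxNorm_dominated_dyadic (N : (D → ℂ) → ℝ≥0∞) (ν : D → ℝ≥0∞) {a : ℝ} (ha : 0 ≤ a)
    {μ : ℝ≥0∞} (hμ : 0 < μ) :
    Dominated (approxNorm N ν a μ) (dyadicApproxNorm N ν a μ) := by
  obtain ⟨C, hC⟩ := exists_haarNorm_le_ellNorm one_pos hμ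
  refine ⟨C * (2 ^ a : ℝ≥0), fun s => (hC _ (fun n => (2 ^ a : ℝ≥0∞) *
    (2 ^ (n * a) * approxError N ν (2 ^ (n : ℝ)) s)) ?_).trans_eq ?_⟩
  · intro n t ht
    rw [mul_one, mul_one] at ht
    rw [← mul_assoc, two_rpow_mul]
    gcongr
    · calc ENNReal.ofReal t ^ a ≤ ENNReal.ofReal (2 ^ ((n + 1 : ℤ) : ℝ)) ^ a := by
            gcongr
            exact ht.2.le
        _ = _ := by
            rw [ofReal_two_rpow, ← ENNReal.rpow_mul]
            push_cast
            ring_nf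
    · exact approxError_anti N ν ht.1 s
  · rw [ellNorm_const_mul hμ, ← mul_assoc, ENNReal.coe_mul, ENNReal.coe_rpow_of_nonneg _ ha]
    rfl

theorem dyadic_dominated_approxNorm (N : (D → ℂ) → ℝ≥0∞) (ν : D → ℝ≥0∞) {a : ℝ} (ha : 0 ≤ a)
    {μ : ℝ≥0∞} (hμ : 0 < μ) :
    Dominated (dyadicApproxNorm N ν a μ) (approxNorm N ν a μ) := by
  obtain ⟨C, hC⟩ := exists_ellNorm_le_haarNorm one_pos hμ
  refine ⟨C * (2 ^ a : ℝ≥0), fun s => ?_⟩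
  have h := hC (fun t => ENNReal.ofReal t ^ a * approxError N ν t s)
    (fun n => 2 ^ (n * a) * approxError N ν (2 ^ ((n + 1 : ℤ) : ℝ)) s) (by
      intro n t ht
      rw [mul_one, mul_one] at ht
      rw [ENNReal.rpow_mul, ← ofReal_two_rpow]
      gcongr
      · exact ht.1
      · exact approxError_anti N ν ht.2.le s)
  calc dyadicApproxNorm N ν a μ s
      = ellNorm μ fun n : ℤ => (2 ^ a : ℝ≥0∞) *
          (2 ^ (n * a) * approxError N ν (2 ^ ((n + 1 : ℤ) : ℝ)) s) := by
        rw [dyadicApproxNorm, ← ellNorm_comp_equiv μ (Equiv.addRight (1 : ℤ))]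
        congr 1
        ext n
        rw [← mul_assoc, two_rpow_mul]
        simp only [Equiv.coe_addRight]
        push_cast
        ring_nf
    _ ≤ 2 ^ a * (C * approxNorm N ν a μ s) := by
        rw [ellNorm_const_mul hμ]
        gcongr
        exact h
    _ = _ := by
        rw [ENNReal.coe_mul, ENNReal.coe_rpow_of_nonneg _ ha, ← mul_assoc, mul_comm (2 ^ a)]
        rfl

theorem interpNorm_dominated_dyadic (N₀ N₁ : (D → ℂ) → ℝ≥0∞) {lam θ : ℝ} (hl : 0 < lam)
    (hθ : 0 ≤ θ) {q : ℝ≥0∞} (hq : 0 < q) :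
    Dominated (interpNorm N₀ N₁ θ q) (dyadicInterpNorm N₀ N₁ lam θ q) := by
  obtain ⟨C, hC⟩ := exists_haarNorm_le_ellNorm hl hq
  refine ⟨C * (2 ^ (θ * lam) : ℝ≥0), fun s => ?_⟩
  have h := hC (fun t => ENNReal.ofReal t ^ (-θ) * peetreK N₀ N₁ t s)
    (fun n => 2 ^ (-(n * (θ * lam))) * peetreK N₀ N₁ (2 ^ (((n + 1 : ℤ) : ℝ) * lam)) s) (by
      intro n t ht
      gcongr
      · rw [ENNReal.rpow_neg, ENNReal.rpow_neg]
        gcongr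
        calc (2 : ℝ≥0∞) ^ (n * (θ * lam)) = ENNReal.ofReal (2 ^ (n * lam)) ^ θ := by
              rw [ofReal_two_rpow, ← ENNReal.rpow_mul]
              ring_nf
          _ ≤ _ := by
              gcongr
              exact ht.1
      · exact peetreK_mono N₀ N₁ ht.2.le s)
  calc interpNorm N₀ N₁ θ q s ≤ _ := h
    _ = C * (2 ^ (θ * lam) * dyadicInterpNorm N₀ N₁ lam θ q s) := by
        congr 1
        rw [dyadicInterpNorm, ← ellNorm_comp_equiv q (Equiv.subRight (1 : ℤ)),
          ← ellNorm_const_mul hq]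
        congr 1
        ext n
        rw [← mul_assoc (2 ^ _ : ℝ≥0∞), two_rpow_mul]
        simp only [Equiv.subRight_apply, sub_add_cancel]
        push_cast
        ring_nf
    _ = _ := by
        rw [ENNReal.coe_mul, ENNReal.coe_rpow_of_nonneg _ (by positivity), mul_assoc]
        rfl

theorem dyadic_dominated_interpNorm (N₀ N₁ : (D → ℂ) → ℝ≥0∞) {lam θ : ℝ} (hl : 0 < lam)
    (hθ : 0 ≤ θ) {q : ℝ≥0∞} (hq : 0 < q) :
    Dominated (dyadicInterpNorm N₀ N₁ lam θ q) (interpNorm N₀ N₁ θ q) := by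
  obtain ⟨C, hC⟩ := exists_ellNorm_le_haarNorm hl hq
  refine ⟨C * (2 ^ (θ * lam) : ℝ≥0), fun s => ?_⟩
  have h := hC (fun t => ENNReal.ofReal t ^ (-θ) * peetreK N₀ N₁ t s)
    (fun n => 2 ^ (-(((n + 1 : ℤ) : ℝ) * (θ * lam))) * peetreK N₀ N₁ (2 ^ ((n : ℝ) * lam)) s) (by
      intro n t ht
      gcongr
      · rw [ENNReal.rpow_neg, ENNReal.rpow_neg]
        gcongr
        calc ENNReal.ofReal t ^ θ ≤ ENNReal.ofReal (2 ^ (((n + 1 : ℤ) : ℝ) * lam)) ^ θ := by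
              gcongr
              exact ht.2.le
          _ = (2 : ℝ≥0∞) ^ (((n + 1 : ℤ) : ℝ) * (θ * lam)) := by
              rw [ofReal_two_rpow, ← ENNReal.rpow_mul]
              ring_nf
      · exact peetreK_mono N₀ N₁ ht.1 s)
  calc dyadicInterpNorm N₀ N₁ lam θ q s
      = 2 ^ (θ * lam) * ellNorm q fun n : ℤ => 2 ^ (-(((n + 1 : ℤ) : ℝ) * (θ * lam))) *
          peetreK N₀ N₁ (2 ^ ((n : ℝ) * lam)) s := by
        rw [dyadicInterpNorm, ← ellNorm_const_mul hq]
        congr 1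
        ext n
        rw [← mul_assoc (2 ^ _ : ℝ≥0∞), two_rpow_mul]
        push_cast
        ring_nf
    _ ≤ 2 ^ (θ * lam) * (C * interpNorm N₀ N₁ θ q s) := by
        gcongr
        exact h
    _ = _ := by
        rw [ENNReal.coe_mul, ENNReal.coe_rpow_of_nonneg _ (by positivity), ← mul_assoc,
          mul_comm (2 ^ _)]
        rfl

/-- This is `K(s, t; 𝕏, 𝕐) = t K(s, 1/t; 𝕐, 𝕏)` combined with the reflection `n ↦ -n`. -/
theorem dyadicInterpNorm_swap (N₀ N₁ : (D → ℂ) → ℝ≥0∞) (lam θ : ℝ) (q : ℝ≥0∞) (s : D → ℂ) :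
    dyadicInterpNorm N₀ N₁ lam θ q s = dyadicInterpNorm N₁ N₀ lam (1 - θ) q s := by
  have hK : ∀ (M₀ M₁ : (D → ℂ) → ℝ≥0∞) (x : ℝ),
      peetreK M₀ M₁ (2 ^ x) s ≤ 2 ^ x * peetreK M₁ M₀ (2 ^ (-x)) s := by
    intro M₀ M₁ x
    conv_rhs => unfold peetreK
    simp_rw [ENNReal.mul_iInf_of_ne (two_rpow_ne_zero _) (two_rpow_ne_top _)]
    refine le_iInf fun h => le_iInf fun g => le_iInf fun e => ?_
    refine (peetreK_le _ (e.trans (add_comm h g))).trans_eq ?_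
    rw [mul_add, ofReal_two_rpow, ofReal_two_rpow, ← mul_assoc, two_rpow_mul, add_neg_cancel,
      ENNReal.rpow_zero, one_mul, add_comm]
  have hle : ∀ (M₀ M₁ : (D → ℂ) → ℝ≥0∞) (θ : ℝ),
      dyadicInterpNorm M₀ M₁ lam θ q s ≤ dyadicInterpNorm M₁ M₀ lam (1 - θ) q s := by
    intro M₀ M₁ θ
    rw [dyadicInterpNorm, dyadicInterpNorm, ← ellNorm_comp_equiv q (Equiv.neg ℤ)]
    refine ellNorm_mono fun n => ?_
    simp only [Equiv.neg_apply]
    push_cast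
    refine (mul_le_mul_right (hK M₀ M₁ _) _).trans_eq ?_
    rw [← mul_assoc, two_rpow_mul]
    ring_nf
  refine le_antisymm (hle _ _ _) ((hle _ _ _).trans_eq ?_)
  rw [sub_sub_cancel]

/-! ### Interpolation of approximation spaces -/

theorem coe_two_rpow (x : ℝ) : (((2 : ℝ≥0) ^ x : ℝ≥0) : ℝ≥0∞) = 2 ^ x := by
  rw [ENNReal.coe_rpow_of_ne_zero (by norm_num)]
  rfl

theorem two_rpow_mul_le_iff (x : ℝ) (a b : ℝ≥0∞) : 2 ^ x * a ≤ b ↔ a ≤ 2 ^ (-x) * b := by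
  rw [ENNReal.rpow_neg, mul_comm (_⁻¹), ← div_eq_mul_inv,
    ENNReal.le_div_iff_mul_le (Or.inl (two_rpow_ne_zero x)) (Or.inl (two_rpow_ne_top x)), mul_comm]

theorem two_rpow_sub_one_add_self (n : ℤ) :
    (2 : ℝ) ^ ((n - 1 : ℤ) : ℝ) + 2 ^ ((n - 1 : ℤ) : ℝ) = 2 ^ (n : ℝ) := by
  push_cast
  rw [Real.rpow_sub two_pos, Real.rpow_one]
  ring

/-- The bound holds for each `n` separately. Only one term of each endpoint quasi-norm is used, so
`μ₀` and `μ₁` play no role. The relations `θ lam = P` and `lam = P + Q` balance the powers of 2. -/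
theorem dyadicApproxNorm_dominated_dyadicInterpNorm {N : (D → ℂ) → ℝ≥0∞} (hN : IsQuasiNorm N)
    (ν : D → ℝ≥0∞) {a P Q lam θ : ℝ} (hP : 0 < a + P) (hQ : 0 < a - Q) (hl : lam = P + Q)
    (hθ : θ * lam = P) {μ₀ μ₁ μ : ℝ≥0∞} (hμ₀ : 0 < μ₀) (hμ₁ : 0 < μ₁) (hμ : 0 < μ) :
    Dominated (dyadicApproxNorm N ν a μ)
      (dyadicInterpNorm (approxNorm N ν (a + P) μ₀) (approxNorm N ν (a - Q) μ₁) lam θ μ) := by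
  obtain ⟨C₀, h₀⟩ := dyadic_dominated_approxNorm N ν hP.le hμ₀
  obtain ⟨C₁, h₁⟩ := dyadic_dominated_approxNorm N ν hQ.le hμ₁
  obtain ⟨c, hc1, hc⟩ := hN.add
  have key : ∀ (b : ℝ) (m : ℝ≥0∞) (_ : 0 < m) (C : ℝ≥0)
      (_ : ∀ f, dyadicApproxNorm N ν b m f ≤ C * approxNorm N ν b m f) (n : ℤ) (f : D → ℂ),
      approxError N ν (2 ^ ((n - 1 : ℤ) : ℝ)) f ≤
        2 ^ (-(((n - 1 : ℤ) : ℝ) * b)) * (C * approxNorm N ν b m f) := by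
    intro b m hm C hC n f
    rw [← two_rpow_mul_le_iff]
    exact (le_ellNorm hm (fun n : ℤ => 2 ^ (n * b) * approxError N ν (2 ^ (n : ℝ)) f) _).trans
      (hC f)
  -- The added 1 keeps the constant nonzero, so that it can be moved inside the infimum defining
  -- `K`.
  refine ⟨c * (2 ^ (a + P) * C₀ + 2 ^ (a - Q) * C₁) + 1, fun f => ellNorm_le_const_mul hμ ?_⟩
  intro n
  set C : ℝ≥0 := c * (2 ^ (a + P) * C₀ + 2 ^ (a - Q) * C₁) + 1 with hCdef
  have hC0 : (C : ℝ≥0∞) ≠ 0 := by positivity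
  unfold peetreK
  rw [← mul_assoc]
  have hC0' : (C : ℝ≥0∞) * 2 ^ (-(n * (θ * lam))) ≠ 0 := mul_ne_zero hC0 (two_rpow_ne_zero _)
  have hCt : (C : ℝ≥0∞) * 2 ^ (-(n * (θ * lam))) ≠ ∞ :=
    ENNReal.mul_ne_top ENNReal.coe_ne_top (two_rpow_ne_top _)
  simp_rw [ENNReal.mul_iInf_of_ne hC0' hCt]
  refine le_iInf fun h => le_iInf fun g => le_iInf fun e => ?_
  have hsum := approxError_add_le hc1 hc ν (s := 2 ^ ((n - 1 : ℤ) : ℝ))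
    (t := 2 ^ ((n - 1 : ℤ) : ℝ)) (by positivity) (by positivity) h g
  rw [two_rpow_sub_one_add_self, ← e] at hsum
  have hle₀ : (c * (2 ^ (a + P) * C₀) : ℝ≥0) ≤ C := by
    rw [hCdef, mul_add, add_assoc]; exact le_self_add
  have hle₁ : (c * (2 ^ (a - Q) * C₁) : ℝ≥0) ≤ C := by
    rw [hCdef, mul_add, add_right_comm]; exact le_add_self
  calc 2 ^ (n * a) * approxError N ν (2 ^ (n : ℝ)) f
      ≤ 2 ^ (n * a) * (c * (2 ^ (-(((n - 1 : ℤ) : ℝ) * (a + P))) *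
          (C₀ * approxNorm N ν (a + P) μ₀ h) + 2 ^ (-(((n - 1 : ℤ) : ℝ) * (a - Q))) *
          (C₁ * approxNorm N ν (a - Q) μ₁ g))) := by
        refine mul_le_mul' le_rfl (hsum.trans ?_)
        gcongr
        · exact key _ _ hμ₀ C₀ h₀ n h
        · exact key _ _ hμ₁ C₁ h₁ n g
    _ = (c * (2 ^ (a + P) * C₀) : ℝ≥0) * 2 ^ (-(n * (θ * lam))) * approxNorm N ν (a + P) μ₀ h +
        (c * (2 ^ (a - Q) * C₁) : ℝ≥0) * 2 ^ (-(n * (θ * lam))) *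
          (2 ^ (n * lam) * approxNorm N ν (a - Q) μ₁ g) := by
        have e₀ : (2 : ℝ≥0∞) ^ (n * a) * 2 ^ (-(((n - 1 : ℤ) : ℝ) * (a + P))) =
            2 ^ (a + P) * 2 ^ (-(n * (θ * lam))) := by
          rw [two_rpow_mul, two_rpow_mul, hθ]
          push_cast
          ring_nf
        have e₁ : (2 : ℝ≥0∞) ^ (n * a) * 2 ^ (-(((n - 1 : ℤ) : ℝ) * (a - Q))) =
            2 ^ (a - Q) * 2 ^ (-(n * (θ * lam))) * 2 ^ (n * lam) := by
          rw [two_rpow_mul, two_rpow_mul, two_rpow_mul, hθ, hl]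
          push_cast
          ring_nf
        push_cast
        rw [coe_two_rpow, coe_two_rpow]
        calc _ = c * C₀ * approxNorm N ν (a + P) μ₀ h *
              (2 ^ (n * a) * 2 ^ (-(((n - 1 : ℤ) : ℝ) * (a + P)))) +
              c * C₁ * approxNorm N ν (a - Q) μ₁ g *
              (2 ^ (n * a) * 2 ^ (-(((n - 1 : ℤ) : ℝ) * (a - Q)))) := by push_cast; ring
          _ = _ := by rw [e₀, e₁]; ring
    _ ≤ C * 2 ^ (-(n * (θ * lam))) * approxNorm N ν (a + P) μ₀ h +
        C * 2 ^ (-(n * (θ * lam))) * (2 ^ (n * lam) * approxNorm N ν (a - Q) μ₁ g) := by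
        gcongr
    _ = _ := by rw [← mul_add, ofReal_two_rpow]

theorem two_rpow_mul_le_of_le {S x : ℝ≥0∞} {a b d : ℝ} (h : x ≤ S * 2 ^ b) (hab : a + b ≤ d) :
    2 ^ a * x ≤ S * 2 ^ d :=
  calc 2 ^ a * x ≤ 2 ^ a * (S * 2 ^ b) := by gcongr
    _ = S * 2 ^ (a + b) := by rw [← two_rpow_mul]; ring
    _ ≤ S * 2 ^ d := mul_le_mul' le_rfl (two_rpow_le hab)

/-- The dyadic approximation quasi-norm of a near-best approximant, and of its remainder. -/
theorem exists_near_best_bounds {N : (D → ℂ) → ℝ≥0∞} (hN : IsQuasiNorm N)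
    (ν : D → ℝ≥0∞) {a P Q δ : ℝ} (haQ : 0 < a - Q) (hδ : 0 < δ)
    (hδP : δ < P) (hδQ : δ < Q)
    {μ₀ μ₁ : ℝ≥0∞} (hμ₀ : 0 < μ₀) (hμ₁ : 0 < μ₁) :
    ∃ C : ℝ≥0, ∀ (f : D → ℂ) (n : ℤ) (S : ℝ≥0∞),
      decaySup δ (fun k : ℤ => 2 ^ (k * a) * approxError N ν (2 ^ (k : ℝ)) f) n < S →
      ∃ g, dyadicApproxNorm N ν (a + P) μ₀ g ≤ C * (S * 2 ^ (n * P)) ∧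
        dyadicApproxNorm N ν (a - Q) μ₁ (f - g) ≤ C * (S * 2 ^ (-(n * Q))) := by
  obtain ⟨c, hc1, hc⟩ := hN.add
  -- `ε` is the geometric decay that survives: the weights in `decaySup` cost `δ` out of `P` and
  -- `Q`, and below level `n` the remainder decays only at rate `a - Q`.
  obtain ⟨ε, hε, hεP, hεQ, hεa⟩ : ∃ ε : ℝ, 0 < ε ∧ ε + δ ≤ P ∧ ε + δ ≤ Q ∧ ε ≤ a - Q :=
    ⟨min (min (P - δ) (Q - δ)) (a - Q), by
      refine lt_min (lt_min ?_ ?_) haQ <;> linarith, by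
      have := (min_le_left (min (P - δ) (Q - δ)) (a - Q)).trans (min_le_left _ _)
      linarith, by
      have := (min_le_left (min (P - δ) (Q - δ)) (a - Q)).trans (min_le_right _ _)
      linarith, min_le_right _ _⟩
  obtain ⟨C₀, h₀⟩ := exists_ellNorm_le_of_decay hμ₀ hε
  obtain ⟨C₁, h₁⟩ := exists_ellNorm_le_of_decay hμ₁ hε
  refine ⟨C₀ * (2 * c) + C₁ * 2 ^ (a - Q + ε), fun f n S hS => ?_⟩
  have hE : ∀ k : ℤ, approxError N ν (2 ^ (k : ℝ)) f ≤ S * 2 ^ (δ * |(k : ℝ) - n| - k * a) := by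
    intro k
    have h := (le_iSup (fun k : ℤ => 2 ^ (k * a) * approxError N ν (2 ^ (k : ℝ)) f *
      2 ^ (-δ * |(k : ℝ) - n|)) k).trans hS.le
    rw [mul_right_comm, two_rpow_mul, two_rpow_mul_le_iff, mul_comm] at h
    refine h.trans_eq ?_
    ring_nf
  -- The term `k = n` of the supremum carries weight 1. Strictness is needed to pick an approximant,
  -- as the infimum need not be attained.
  have hEn : approxError N ν (2 ^ (n : ℝ)) f < S * 2 ^ (-(n * a)) := by
    have h := (le_iSup (fun k : ℤ => 2 ^ (k * a) * approxError N ν (2 ^ (k : ℝ)) f *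
      2 ^ (-δ * |(k : ℝ) - n|)) n).trans_lt hS
    simp only [sub_self, abs_zero, mul_zero, ENNReal.rpow_zero, mul_one] at h
    by_contra! hcon
    rw [mul_comm, two_rpow_mul_le_iff, neg_neg] at hcon
    exact (h.trans_le hcon).false
  obtain ⟨g, hg, hgN⟩ := exists_mem_Sig_of_approxError_lt hEn
  refine ⟨g, ?_, ?_⟩
  · have hz : ∀ k : ℤ, 2 ^ (k * (a + P)) * approxError N ν (2 ^ (k : ℝ)) g ≤
        (2 * c * (S * 2 ^ (n * P))) * 2 ^ (-ε * |(k : ℝ) - n|) := by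
      intro k
      rcases le_or_gt n k with hk | hk
      -- At levels `k ≥ n`, `g` is its own approximant.
      · rw [approxError_eq_zero hN.zero (Sig_mono ν (Real.rpow_le_rpow_of_exponent_le
          one_le_two (by exact_mod_cast hk)) hg), mul_zero]
        exact zero_le
      · have hk' : (k : ℝ) < n := by exact_mod_cast hk
        have hkn : 0 < (n : ℝ) - k := by linarith
        have habs : |(k : ℝ) - n| = n - k := by rw [abs_of_neg (by linarith)]; ring
        have hcl := approxError_le_of_close hN.neg hc1 hc ν (2 ^ (k : ℝ)) f g
        have hd₁ : 2 ^ (k * (a + P)) * N (f - g) ≤ S * 2 ^ (n * P - ε * (n - k)) :=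
          two_rpow_mul_le_of_le hgN.le (by nlinarith)
        have hd₂ : 2 ^ (k * (a + P)) * approxError N ν (2 ^ (k : ℝ)) f ≤
            S * 2 ^ (n * P - ε * (n - k)) :=
          two_rpow_mul_le_of_le (hE k) (by rw [habs]; nlinarith)
        calc 2 ^ (k * (a + P)) * approxError N ν (2 ^ (k : ℝ)) g
            ≤ 2 ^ (k * (a + P)) * (c * (N (f - g) + approxError N ν (2 ^ (k : ℝ)) f)) := by
              gcongr
          _ = c * (2 ^ (k * (a + P)) * N (f - g) +
                2 ^ (k * (a + P)) * approxError N ν (2 ^ (k : ℝ)) f) := by ring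
          _ ≤ c * (S * 2 ^ (n * P - ε * (n - k)) + S * 2 ^ (n * P - ε * (n - k))) := by gcongr
          _ = _ := by
              rw [habs, ← two_mul, mul_assoc (2 * (c : ℝ≥0∞)), mul_assoc S, two_rpow_mul]
              ring_nf
    calc dyadicApproxNorm N ν (a + P) μ₀ g ≤ C₀ * (2 * c * (S * 2 ^ (n * P))) := h₀ n _ _ hz
      _ = (C₀ * (2 * c) : ℝ≥0) * (S * 2 ^ (n * P)) := by push_cast; ring
      _ ≤ _ := by
          gcongr
          exact le_self_add
  · have hz : ∀ k : ℤ, 2 ^ (k * (a - Q)) * approxError N ν (2 ^ (k : ℝ)) (f - g) ≤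
        (2 ^ (a - Q + ε) * (S * 2 ^ (-(n * Q)))) * 2 ^ (-ε * |(k : ℝ) - n|) := by
      intro k
      have hrhs : (2 ^ (a - Q + ε) * (S * 2 ^ (-(n * Q)))) * 2 ^ (-ε * |(k : ℝ) - n|) =
          S * 2 ^ (a - Q + ε - n * Q - ε * |(k : ℝ) - n|) := by
        rw [mul_left_comm, two_rpow_mul, mul_assoc, two_rpow_mul]
        ring_nf
      rw [hrhs]
      rcases le_or_gt k n with hk | hk
      · have hk' : (k : ℝ) ≤ n := by exact_mod_cast hk
        have habs : |(k : ℝ) - n| = n - k := by rw [abs_of_nonpos (by linarith)]; ring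
        exact two_rpow_mul_le_of_le ((approxError_le_self N ν _ _).trans hgN.le)
          (by rw [habs]; nlinarith)
      -- Beyond level `n`, subtracting `g` from an approximant of `f` at level `k - 1` costs
      -- `2^(k-1) + 2^n ≤ 2^k`. This shift by one level produces the factor `2^(a - Q + ε)`.
      · have hk' : (n : ℝ) ≤ (k - 1 : ℤ) := by exact_mod_cast Int.le_sub_one_of_lt hk
        have hk'' : (n : ℝ) ≤ k - 1 := by exact_mod_cast hk'
        have habs : |(k : ℝ) - n| = k - n := abs_of_nonneg (by linarith)
        have habs' : |((k - 1 : ℤ) : ℝ) - n| = k - 1 - n := by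
          rw [abs_of_nonneg (by linarith)]; push_cast; ring
        have hstep : approxError N ν (2 ^ (k : ℝ)) (f - g) ≤
            approxError N ν (2 ^ ((k - 1 : ℤ) : ℝ)) f := by
          refine le_iInf₂ fun h hh => ?_
          have hm : h - g ∈ Sig ν (2 ^ (k : ℝ)) := by
            rw [sub_eq_add_neg, ← two_rpow_sub_one_add_self]
            exact add_mem_Sig (by positivity) (by positivity) hh (neg_mem_Sig
              (Sig_mono ν (Real.rpow_le_rpow_of_exponent_le one_le_two hk') hg))
          refine (approxError_le _ hm).trans_eq ?_
          congr 1
          abel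
        refine two_rpow_mul_le_of_le (hstep.trans (hE _)) ?_
        rw [habs, habs']
        push_cast
        nlinarith
    calc dyadicApproxNorm N ν (a - Q) μ₁ (f - g)
        ≤ C₁ * (2 ^ (a - Q + ε) * (S * 2 ^ (-(n * Q)))) := h₁ n _ _ hz
      _ = (C₁ * 2 ^ (a - Q + ε) : ℝ≥0) * (S * 2 ^ (-(n * Q))) := by
          rw [ENNReal.coe_mul, coe_two_rpow]; ring
      _ ≤ _ := by
          gcongr
          exact le_add_self

theorem dyadicInterpNorm_dominated_dyadicApproxNorm {N : (D → ℂ) → ℝ≥0∞} (hN : IsQuasiNorm N)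
    (ν : D → ℝ≥0∞) {a P Q lam θ : ℝ} (hP : 0 < P) (hQ : 0 < Q) (haQ : 0 < a - Q)
    (hl : lam = P + Q) (hθ : θ * lam = P) {μ₀ μ₁ μ : ℝ≥0∞} (hμ₀ : 0 < μ₀) (hμ₁ : 0 < μ₁)
    (hμ : 0 < μ) :
    Dominated (dyadicInterpNorm (approxNorm N ν (a + P) μ₀) (approxNorm N ν (a - Q) μ₁) lam θ μ)
      (dyadicApproxNorm N ν a μ) := by
  obtain ⟨δ, hδ, hδP, hδQ⟩ : ∃ δ : ℝ, 0 < δ ∧ δ < P ∧ δ < Q :=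
    ⟨min P Q / 2, by positivity, by linarith [min_le_left P Q, lt_min hP hQ],
      by linarith [min_le_right P Q, lt_min hP hQ]⟩
  obtain ⟨C₀, h₀⟩ := approxNorm_dominated_dyadic N ν (a := a + P) (by linarith) hμ₀
  obtain ⟨C₁, h₁⟩ := approxNorm_dominated_dyadic N ν haQ.le hμ₁
  obtain ⟨C, hC⟩ := exists_near_best_bounds hN ν haQ hδ hδP hδQ hμ₀ hμ₁
  obtain ⟨B, hB⟩ := exists_ellNorm_decaySup_le hμ hδ
  set A : ℝ≥0 := C₀ * C + C₁ * C + 1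
  refine ⟨A * B, fun f => ?_⟩
  rw [ENNReal.coe_mul, mul_assoc]
  refine le_trans (ellNorm_le_const_mul hμ (C := (A : ℝ≥0∞)) fun n => ?_)
    (mul_le_mul' le_rfl (hB fun k : ℤ => 2 ^ (k * a) * approxError N ν (2 ^ (k : ℝ)) f))
  refine le_mul_of_forall_gt (by exact_mod_cast le_add_self) ENNReal.coe_ne_top fun S hS => ?_
  obtain ⟨g, hg, hfg⟩ := hC f n S hS
  calc 2 ^ (-(n * (θ * lam))) *
        peetreK (approxNorm N ν (a + P) μ₀) (approxNorm N ν (a - Q) μ₁) (2 ^ (n * lam)) f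
      ≤ 2 ^ (-(n * (θ * lam))) * (C₀ * (C * (S * 2 ^ (n * P))) +
          2 ^ (n * lam) * (C₁ * (C * (S * 2 ^ (-(n * Q)))))) := by
        refine mul_le_mul' le_rfl ((peetreK_le _ (add_sub_cancel g f).symm).trans ?_)
        rw [ofReal_two_rpow]
        gcongr
        · exact (h₀ g).trans (by gcongr)
        · exact (h₁ _).trans (by gcongr)
    _ = C₀ * C * S * (2 ^ (-(n * (θ * lam))) * 2 ^ (n * P)) +
          C₁ * C * S * (2 ^ (-(n * (θ * lam))) * 2 ^ (n * lam) * 2 ^ (-(n * Q))) := by ring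
    _ = (C₀ * C + C₁ * C : ℝ≥0) * S := by
        have e₀ : -((n : ℝ) * (θ * lam)) + n * P = 0 := by rw [hθ]; ring
        have e₁ : -((n : ℝ) * (θ * lam)) + n * lam + -(n * Q) = 0 := by rw [hθ, hl]; ring
        rw [two_rpow_mul, two_rpow_mul, two_rpow_mul, e₀, e₁, ENNReal.rpow_zero]
        push_cast
        ring
    _ ≤ A * S := by
        gcongr
        exact le_self_add

/-- Approximation spaces with the same underlying quasi-norm are stable under real
interpolation. -/
theorem interpNorm_approxNorm {N : (D → ℂ) → ℝ≥0∞} (hN : IsQuasiNorm N)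
    (ν : D → ℝ≥0∞) {a₀ a₁ a θ : ℝ} (h₀ : 0 < a₀) (h₁ : 0 < a₁) (hne : a₀ ≠ a₁)
    (hθ : θ ∈ Ioo (0 : ℝ) 1) (ha : a = (1 - θ) * a₀ + θ * a₁) {μ₀ μ₁ μ : ℝ≥0∞} (hμ₀ : 0 < μ₀)
    (hμ₁ : 0 < μ₁) (hμ : 0 < μ) :
    Dominated (interpNorm (approxNorm N ν a₀ μ₀) (approxNorm N ν a₁ μ₁) θ μ)
        (approxNorm N ν a μ) ∧
      Dominated (approxNorm N ν a μ)
        (interpNorm (approxNorm N ν a₀ μ₀) (approxNorm N ν a₁ μ₁) θ μ) := by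
  have hθ' : 0 < 1 - θ := by linarith [hθ.2]
  have hapos : 0 < a := by
    have := hθ.1
    rw [ha]; positivity
  -- The dyadic estimates require the larger exponent at the first endpoint. The other order is
  -- reduced to this one by exchanging the endpoints and replacing `θ` by `1 - θ`.
  have main : ∀ (b₀ b₁ η : ℝ) (m₀ m₁ : ℝ≥0∞), 0 < m₀ → 0 < m₁ → 0 < b₁ → b₁ < b₀ → 0 < η →
      η < 1 → a = (1 - η) * b₀ + η * b₁ →
      Dominated (dyadicInterpNorm (approxNorm N ν b₀ m₀) (approxNorm N ν b₁ m₁) (b₀ - b₁) η μ)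
        (approxNorm N ν a μ) ∧
      Dominated (approxNorm N ν a μ)
        (dyadicInterpNorm (approxNorm N ν b₀ m₀) (approxNorm N ν b₁ m₁) (b₀ - b₁) η μ) := by
    intro b₀ b₁ η m₀ m₁ hm₀ hm₁ hb₁ hb hη hη1 hab
    have hlam : 0 < b₀ - b₁ := by linarith
    have hP : 0 < η * (b₀ - b₁) := by positivity
    have hQ : 0 < (1 - η) * (b₀ - b₁) := mul_pos (by linarith) hlam
    have e₀ : b₀ = a + η * (b₀ - b₁) := by rw [hab]; ring
    have e₁ : b₁ = a - (1 - η) * (b₀ - b₁) := by rw [hab]; ring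
    have hl : b₀ - b₁ = η * (b₀ - b₁) + (1 - η) * (b₀ - b₁) := by ring
    have d₁ := dyadicInterpNorm_dominated_dyadicApproxNorm hN ν (a := a) hP hQ (by rwa [← e₁])
      hl rfl hm₀ hm₁ hμ
    have d₂ := dyadicApproxNorm_dominated_dyadicInterpNorm hN ν (a := a) (by linarith)
      (by rwa [← e₁]) hl rfl hm₀ hm₁ hμ
    rw [← e₀, ← e₁] at d₁ d₂
    exact ⟨d₁.trans (dyadic_dominated_approxNorm N ν hapos.le hμ),
      (approxNorm_dominated_dyadic N ν hapos.le hμ).trans d₂⟩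
  rcases lt_or_gt_of_ne hne with hlt | hlt
  · have hlam : 0 < a₁ - a₀ := by linarith
    obtain ⟨d₁, d₂⟩ := main a₁ a₀ (1 - θ) μ₁ μ₀ hμ₁ hμ₀ h₀ hlt hθ' (by linarith [hθ.1])
      (by rw [ha]; ring)
    have hsw : dyadicInterpNorm (approxNorm N ν a₁ μ₁) (approxNorm N ν a₀ μ₀) (a₁ - a₀) (1 - θ) μ =
        dyadicInterpNorm (approxNorm N ν a₀ μ₀) (approxNorm N ν a₁ μ₁) (a₁ - a₀) θ μ :=
      funext fun s => (dyadicInterpNorm_swap _ _ _ _ _ s).symm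
    rw [hsw] at d₁ d₂
    exact ⟨(interpNorm_dominated_dyadic _ _ hlam hθ.1.le hμ).trans d₁,
      d₂.trans (dyadic_dominated_interpNorm _ _ hlam hθ.1.le hμ)⟩
  · have hlam : 0 < a₀ - a₁ := by linarith
    obtain ⟨d₁, d₂⟩ := main a₀ a₁ θ μ₀ μ₁ hμ₀ hμ₁ h₁ hlt hθ.1 hθ.2 ha
    exact ⟨(interpNorm_dominated_dyadic _ _ hlam hθ.1.le hμ).trans d₁,
      d₂.trans (dyadic_dominated_interpNorm _ _ hlam hθ.1.le hμ)⟩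

/-- Interpolating a quasi-normed space with itself gives nothing new. -/
theorem interpNorm_self {N : (D → ℂ) → ℝ≥0∞} (hN : IsQuasiNorm N) {θ : ℝ}
    (hθ : θ ∈ Ioo (0 : ℝ) 1) {q : ℝ≥0∞} (hq : 0 < q) :
    Dominated (interpNorm N N θ q) N ∧ Dominated N (interpNorm N N θ q) := by
  obtain ⟨c, hc1, hc⟩ := hN.add
  constructor
  · refine (interpNorm_dominated_dyadic N N one_pos hθ.1.le hq).trans ?_
    obtain ⟨ε, hε, hεθ, hεθ'⟩ : ∃ ε : ℝ, 0 < ε ∧ ε ≤ θ ∧ ε ≤ 1 - θ :=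
      ⟨min θ (1 - θ), lt_min hθ.1 (by linarith [hθ.2]), min_le_left _ _, min_le_right _ _⟩
    obtain ⟨C, hC⟩ := exists_ellNorm_le_of_decay hq hε
    refine ⟨C, fun s => hC 0 (N s) _ fun n => ?_⟩
    simp only [mul_one, Int.cast_zero, sub_zero]
    -- The two trivial splittings give `K(s, t) ≤ min(1, t) N s`, hence decay in both directions.
    have k₀ := peetreK_le (N₀ := N) (N₁ := N) (2 ^ (n : ℝ)) (add_zero s).symm
    have k₁ := peetreK_le (N₀ := N) (N₁ := N) (2 ^ (n : ℝ)) (zero_add s).symm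
    rw [hN.zero, mul_zero, add_zero, ← mul_one (N s), ← ENNReal.rpow_zero (x := 2)] at k₀
    rw [hN.zero, zero_add, ofReal_two_rpow, mul_comm] at k₁
    rcases le_total 0 (n : ℝ) with h | h
    · refine two_rpow_mul_le_of_le k₀ ?_
      rw [abs_of_nonneg h]
      nlinarith
    · refine two_rpow_mul_le_of_le k₁ ?_
      rw [abs_of_nonpos h]
      nlinarith
  · refine Dominated.trans ?_ (dyadic_dominated_interpNorm N N one_pos hθ.1.le hq)
    refine ⟨c, fun s => ?_⟩
    -- The term `n = 0` suffices: by the quasi-triangle inequality, `N s ≤ c K(s, 1)`.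
    have h := le_ellNorm hq
      (fun n : ℤ => 2 ^ (-(n * (θ * 1))) * peetreK N N (2 ^ ((n : ℝ) * 1)) s) 0
    simp only [Int.cast_zero, zero_mul, neg_zero, ENNReal.rpow_zero, one_mul, Real.rpow_zero] at h
    refine le_trans ?_ (mul_le_mul' le_rfl h)
    unfold peetreK
    have hc0 : (c : ℝ≥0∞) ≠ 0 := by positivity
    simp_rw [ENNReal.mul_iInf_of_ne hc0 ENNReal.coe_ne_top]
    refine le_iInf fun h => le_iInf fun g => le_iInf fun e => ?_
    rw [e, ENNReal.ofReal_one, one_mul]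
    exact hc h g

theorem IsQuasiNorm.of_dominated {N N' : (D → ℂ) → ℝ≥0∞} (hN' : IsQuasiNorm N')
    (h : Dominated N N') (h' : Dominated N' N) (hneg : ∀ f, N (-f) = N f) : IsQuasiNorm N := by
  obtain ⟨C, hC1, hC⟩ := h.one_le
  obtain ⟨C', hC1', hC'⟩ := h'.one_le
  obtain ⟨c, hc1, hc⟩ := hN'.add
  refine ⟨?_, hneg, C * (c * C'), ?_, fun f g => ?_⟩
  · have := hC 0
    rwa [hN'.zero, mul_zero, nonpos_iff_eq_zero] at this
  · exact one_le_mul hC1 (one_le_mul hc1 hC1')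
  · calc N (f + g) ≤ C * (c * (C' * N f + C' * N g)) := by
          refine (hC _).trans ?_
          gcongr
          refine (hc f g).trans ?_
          gcongr
          · exact hC' f
          · exact hC' g
      _ = _ := by push_cast; ring

/-! ### Lorentz spaces as approximation spaces -/

/-- The weighted `ℓ^∞` norm. -/
noncomputable def weightedSupNorm (u : D → ℝ) (s : D → ℂ) : ℝ≥0∞ := ⨆ I, ‖(u I : ℂ) * s I‖ₑ

theorem isQuasiNorm_weightedSupNorm (u : D → ℝ) : IsQuasiNorm (weightedSupNorm u) where
  zero := by simp [weightedSupNorm]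
  neg f := by simp [weightedSupNorm]
  add := by
    refine ⟨1, le_rfl, fun f g => ?_⟩
    rw [ENNReal.coe_one, one_mul]
    refine iSup_le fun I => ?_
    rw [Pi.add_apply, mul_add]
    exact (enorm_add_le _ _).trans (add_le_add (le_iSup (fun I => ‖(u I : ℂ) * f I‖ₑ) I)
      (le_iSup (fun I => ‖(u I : ℂ) * g I‖ₑ) I))

/-- In a weighted supremum norm, hard thresholding is optimal: keeping the entries with `|u s| > l`
leaves an error at most `l`. Conversely, any entry exceeding the error of an approximant must lie in
its `Γ`. -/
theorem rearr_eq_approxError (u : D → ℝ) (ν : D → ℝ≥0∞) (s : D → ℂ) (t : ℝ) :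
    rearr ν (fun I => (u I : ℂ) * s I) t = approxError (weightedSupNorm u) ν t s := by
  classical
  apply le_antisymm
  · refine le_iInf₂ fun g ⟨Γ, hΓ, hg⟩ => le_of_forall_gt fun M hM => ?_
    obtain ⟨l, hl, hlM⟩ := ENNReal.lt_iff_exists_nnreal_btwn.1 hM
    refine lt_of_le_of_lt (iInf₂_le l ⟨?_, (meas_mono ν fun I hI => ?_).trans hΓ⟩) hlM
    · exact_mod_cast zero_le.trans_lt hl
    · by_contra hI'
      have h := (le_iSup (fun I => ‖(u I : ℂ) * (s - g) I‖ₑ) I).trans_lt hl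
      rw [Pi.sub_apply, hg I hI', sub_zero] at h
      exact (h.trans hI).false
  · refine le_iInf₂ fun l ⟨_, hl⟩ => ?_
    refine (approxError_le (N := weightedSupNorm u) s
      (g := fun I => if (l : ℝ≥0∞) < ‖(u I : ℂ) * s I‖ₑ then s I else 0)
      ⟨_, hl, fun I hI => if_neg hI⟩).trans (iSup_le fun I => ?_)
    by_cases h : (l : ℝ≥0∞) < ‖(u I : ℂ) * s I‖ₑ
    · rw [Pi.sub_apply, if_pos h, sub_self, mul_zero, enorm_zero]
      exact zero_le
    · rw [Pi.sub_apply, if_neg h, sub_zero]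
      exact le_of_not_gt h

theorem weightedLorentzNorm_eq_approxNorm (u : D → ℝ) (ν : D → ℝ≥0∞) (p : ℝ) (μ : ℝ≥0∞) :
    weightedLorentzNorm u ν p μ = approxNorm (weightedSupNorm u) ν (1 / p) μ := by
  ext s
  simp only [weightedLorentzNorm, lorentzNorm, approxNorm, rearr_eq_approxError]

/-! ### The layer cake formula for the rearrangement -/

theorem rearr_anti (ν : D → ℝ≥0∞) (f : D → ℂ) : Antitone (rearr ν f) := by
  intro t t' h
  refine le_iInf₂ fun l hl => iInf₂_le l ⟨hl.1, hl.2.trans (ENNReal.ofReal_le_ofReal h)⟩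

/-- The measure on all subsets of `D` with point masses `ν I`. -/
noncomputable def pointMeasure (ν : D → ℝ≥0∞) : @Measure D ⊤ :=
  @Measure.sum D D ⊤ fun I => ν I • @Measure.dirac D ⊤ I

theorem pointMeasure_apply (ν : D → ℝ≥0∞) (Γ : Set D) : pointMeasure ν Γ = meas ν Γ := by
  let _ : MeasurableSpace D := ⊤
  rw [pointMeasure, Measure.sum_apply _ MeasurableSpace.measurableSet_top, meas, tsum_subtype]
  congr 1
  ext I
  rw [Measure.smul_apply, Measure.dirac_apply' _ MeasurableSpace.measurableSet_top]
  by_cases h : I ∈ Γ <;> simp [h]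

theorem lintegral_pointMeasure (ν : D → ℝ≥0∞) (f : D → ℝ≥0∞) :
    @lintegral D ⊤ (pointMeasure ν) f = ∑' I, f I * ν I := by
  let _ : MeasurableSpace D := ⊤
  rw [pointMeasure, lintegral_sum_measure]
  congr 1
  ext I
  rw [lintegral_smul_measure, lintegral_dirac' _ measurable_from_top, smul_eq_mul, mul_comm]

/-- The content is that positive levels at or above the infimum are admissible: the superlevel set
at `l` is the increasing union of those at `l + 1/(n+1)`, and measures are continuous from below. -/
theorem lt_rearr_iff (ν : D → ℝ≥0∞) (f : D → ℂ) (t : ℝ) {l : ℝ≥0} (hl : 0 < l) :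
    (l : ℝ≥0∞) < rearr ν f t ↔ ENNReal.ofReal t < meas ν {I | (l : ℝ≥0∞) < ‖f I‖ₑ} := by
  rw [← not_le, ← not_le, not_iff_not]
  constructor
  · intro h
    have hU : {I | (l : ℝ≥0∞) < ‖f I‖ₑ} =
        ⋃ n : ℕ, {I | ((l + 1 / ((n : ℝ≥0) + 1) : ℝ≥0) : ℝ≥0∞) < ‖f I‖ₑ} := by
      ext I
      simp only [mem_ofPred_eq, mem_iUnion]
      constructor
      · intro hI
        rw [← ofReal_norm, ← ENNReal.ofReal_coe_nnreal,
          ENNReal.ofReal_lt_ofReal_iff_of_nonneg l.coe_nonneg] at hI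
        obtain ⟨n, hn⟩ := exists_nat_one_div_lt (sub_pos.2 hI)
        refine ⟨n, ?_⟩
        rw [← ofReal_norm, ← ENNReal.ofReal_coe_nnreal,
          ENNReal.ofReal_lt_ofReal_iff_of_nonneg (NNReal.coe_nonneg _)]
        push_cast
        linarith
      · rintro ⟨n, hn⟩
        refine lt_of_le_of_lt ?_ hn
        exact_mod_cast le_self_add
    let _ : MeasurableSpace D := ⊤
    rw [← pointMeasure_apply, hU, Monotone.measure_iUnion]
    · refine iSup_le fun n => ?_
      have hlt : rearr ν f t < ((l + 1 / ((n : ℝ≥0) + 1) : ℝ≥0) : ℝ≥0∞) := by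
        refine h.trans_lt ?_
        exact_mod_cast lt_add_of_pos_right l (by positivity : (0 : ℝ≥0) < 1 / ((n : ℝ≥0) + 1))
      simp only [rearr, iInf_lt_iff] at hlt
      obtain ⟨l', ⟨_, hl'⟩, hlt⟩ := hlt
      rw [pointMeasure_apply]
      exact (meas_mono ν fun I hI => hlt.trans hI).trans hl'
    · intro m n hmn I hI
      rw [mem_ofPred_eq] at hI ⊢
      refine lt_of_le_of_lt ?_ hI
      have : (m : ℝ≥0) ≤ n := by exact_mod_cast hmn
      have : 1 / ((n : ℝ≥0) + 1) ≤ 1 / ((m : ℝ≥0) + 1) := by gcongr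
      exact_mod_cast add_le_add_right this l
  · exact fun h => iInf₂_le l ⟨hl, h⟩

theorem volume_setOf_ofReal_lt (c : ℝ≥0∞) :
    volume {t : ℝ | 0 < t ∧ ENNReal.ofReal t < c} = c := by
  rcases eq_or_ne c ∞ with rfl | hc
  · have : {t : ℝ | 0 < t ∧ ENNReal.ofReal t < ∞} = Ioi 0 := by ext; simp
    rw [this, Real.volume_Ioi]
  · have : {t : ℝ | 0 < t ∧ ENNReal.ofReal t < c} = Ioo 0 c.toReal := by
      ext t
      simp only [mem_ofPred_eq, mem_Ioo]
      refine and_congr_right fun ht => ?_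
      rw [ENNReal.ofReal_lt_iff_lt_toReal ht.le hc]
    rw [this, Real.volume_Ioo, sub_zero, ENNReal.ofReal_toReal hc]

/-- Equimeasurability: `∫₀^∞ f*_ν(t)^r dt = ∑_I |f_I|^r ν(I)`. -/
theorem lintegral_rearr_rpow (ν : D → ℝ≥0∞) (f : D → ℂ) {r : ℝ} (hr : 0 < r) :
    ∫⁻ t in Ioi (0 : ℝ), rearr ν f t ^ r = ∑' I, ‖f I‖ₑ ^ r * ν I := by
  let _ : MeasurableSpace D := ⊤
  rw [← lintegral_pointMeasure]
  -- The layer cake formula is applied to real-valued functions, so an infinite rearrangement is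
  -- treated separately.
  by_cases hfin : ∀ t, 0 < t → rearr ν f t ≠ ∞
  · have hL := lintegral_rpow_eq_lintegral_meas_lt_mul (volume.restrict (Ioi (0 : ℝ)))
      (f := fun t => (rearr ν f t).toReal) (Filter.Eventually.of_forall fun _ =>
        ENNReal.toReal_nonneg) (rearr_anti ν f).measurable.ennreal_toReal.aemeasurable hr
    have hR := lintegral_rpow_eq_lintegral_meas_lt_mul (pointMeasure ν)
      (f := fun I => ‖f I‖) (Filter.Eventually.of_forall fun _ => norm_nonneg _)
      measurable_from_top.aemeasurable hr
    have eL : ∫⁻ t in Ioi (0 : ℝ), rearr ν f t ^ r =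
        ∫⁻ t in Ioi (0 : ℝ), ENNReal.ofReal ((rearr ν f t).toReal ^ r) := by
      refine setLIntegral_congr_fun measurableSet_Ioi fun t ht => ?_
      rw [← ENNReal.ofReal_rpow_of_nonneg ENNReal.toReal_nonneg hr.le,
        ENNReal.ofReal_toReal (hfin t ht)]
    have eR : ∫⁻ I, ‖f I‖ₑ ^ r ∂(pointMeasure ν) =
        ∫⁻ I, ENNReal.ofReal (‖f I‖ ^ r) ∂(pointMeasure ν) := by
      congr 1
      ext I
      rw [← ENNReal.ofReal_rpow_of_nonneg (norm_nonneg _) hr.le, ofReal_norm]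
    rw [eL, eR, hL, hR]
    congr 1
    refine setLIntegral_congr_fun measurableSet_Ioi fun x hx => ?_
    congr 1
    have hx' : 0 < x.toNNReal := Real.toNNReal_pos.2 hx
    rw [pointMeasure_apply, Measure.restrict_apply' measurableSet_Ioi]
    have e₁ : {I | x < ‖f I‖} = {I | ((x.toNNReal : ℝ≥0) : ℝ≥0∞) < ‖f I‖ₑ} := by
      ext I
      simp only [mem_ofPred_eq]
      rw [← ofReal_norm]
      exact (ENNReal.ofReal_lt_ofReal_iff_of_nonneg (le_of_lt hx)).symm
    have e₂ : {t | x < (rearr ν f t).toReal} ∩ Ioi 0 =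
        {t | 0 < t ∧ ENNReal.ofReal t < meas ν {I | ((x.toNNReal : ℝ≥0) : ℝ≥0∞) < ‖f I‖ₑ}} := by
      ext t
      simp only [mem_inter_iff, mem_ofPred_eq, mem_Ioi]
      rw [and_comm]
      refine and_congr_right fun ht => ?_
      rw [← lt_rearr_iff ν f t hx', ← ENNReal.ofReal_lt_iff_lt_toReal (le_of_lt hx) (hfin t ht)]
      rfl
    rw [e₂, e₁, volume_setOf_ofReal_lt]
  · push Not at hfin
    obtain ⟨t₀, ht₀, htop⟩ := hfin
    have hl : ∫⁻ t in Ioi (0 : ℝ), rearr ν f t ^ r = ∞ := by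
      rw [eq_top_iff]
      calc (∞ : ℝ≥0∞) = ∫⁻ _ in Ioo (0 : ℝ) t₀, ∞ := by
            rw [setLIntegral_const, Real.volume_Ioo, ENNReal.top_mul (by simpa using ht₀)]
        _ ≤ ∫⁻ t in Ioo (0 : ℝ) t₀, rearr ν f t ^ r := by
            refine setLIntegral_mono' measurableSet_Ioo fun t ht => ?_
            have : rearr ν f t = ∞ := top_le_iff.1 (htop ▸ rearr_anti ν f ht.2.le)
            rw [this, ENNReal.top_rpow_of_pos hr]
        _ ≤ _ := lintegral_mono_set Ioo_subset_Ioi_self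
    rw [hl]
    refine (ENNReal.eq_top_of_forall_nnreal_le fun x => ?_).symm
    have h0 : ENNReal.ofReal t₀ ≠ 0 := by simpa using ht₀
    -- Chosen so that `y^r t₀ ≥ x`; the added 1 makes it positive. Markov's inequality at height
    -- `y^r` then bounds the sum below by the arbitrary `x`.
    set y : ℝ≥0 := (x / t₀.toNNReal) ^ (1 / r) + 1
    have hy : 0 < y := by positivity
    have hmeas : ENNReal.ofReal t₀ ≤ pointMeasure ν {I | ((y : ℝ≥0∞)) ^ r ≤ ‖f I‖ₑ ^ r} := by
      have := (lt_rearr_iff ν f t₀ hy).1 (by rw [htop]; exact ENNReal.coe_lt_top)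
      rw [pointMeasure_apply]
      refine this.le.trans (meas_mono ν fun I hI => ?_)
      exact ENNReal.rpow_le_rpow (le_of_lt hI) hr.le
    refine le_trans ?_ (mul_meas_ge_le_lintegral (μ := pointMeasure ν)
      (f := fun I => ‖f I‖ₑ ^ r) measurable_from_top ((y : ℝ≥0∞) ^ r))
    refine le_trans ?_ (mul_le_mul' le_rfl hmeas)
    have hxy : x ≤ y ^ r * t₀.toNNReal := by
      have ht0 : 0 < t₀.toNNReal := Real.toNNReal_pos.2 ht₀
      rw [← div_le_iff₀ ht0]
      calc x / t₀.toNNReal = ((x / t₀.toNNReal) ^ (1 / r)) ^ r := by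
            rw [← NNReal.rpow_mul, one_div_mul_cancel hr.ne', NNReal.rpow_one]
        _ ≤ y ^ r := by
            gcongr
            exact le_self_add
    rw [← ENNReal.coe_rpow_of_nonneg _ hr.le]
    have := ENNReal.coe_le_coe.2 hxy
    rwa [ENNReal.coe_mul] at this

/-- The weighted Lebesgue quasi-norm `(∑_I |u_I s_I|^r ν(I))^{1/r}`. -/
noncomputable def weightedLpNorm (u : D → ℝ) (ν : D → ℝ≥0∞) (r : ℝ) (s : D → ℂ) : ℝ≥0∞ :=
  (∑' I, ‖(u I : ℂ) * s I‖ₑ ^ r * ν I) ^ (1 / r)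

theorem weightedLorentzNorm_eq_weightedLpNorm (u : D → ℝ) (ν : D → ℝ≥0∞) {r : ℝ} (hr : 0 < r) :
    weightedLorentzNorm u ν r (ENNReal.ofReal r) = weightedLpNorm u ν r := by
  ext s
  rw [weightedLorentzNorm, lorentzNorm, haarNorm, if_neg ENNReal.ofReal_ne_top,
    ENNReal.toReal_ofReal hr.le, weightedLpNorm, ← lintegral_rearr_rpow ν _ hr]
  congr 1
  refine setLIntegral_congr_fun measurableSet_Ioi fun t ht => ?_
  have h0 : ENNReal.ofReal t ≠ 0 := by simpa using ht
  rw [ENNReal.mul_rpow_of_nonneg _ _ hr.le, ← ENNReal.rpow_mul, one_div_mul_cancel hr.ne',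
    ENNReal.rpow_one, mul_comm, mul_div_assoc, ENNReal.div_self h0 ENNReal.ofReal_ne_top,
    mul_one]

theorem isQuasiNorm_weightedLpNorm (u : D → ℝ) (ν : D → ℝ≥0∞) {r : ℝ} (hr : 0 < r) :
    IsQuasiNorm (weightedLpNorm u ν r) := by
  have hE : ∀ s, weightedLpNorm u ν r s =
      ellNorm (ENNReal.ofReal r) fun I => ‖(u I : ℂ) * s I‖ₑ * ν I ^ (1 / r) := by
    intro s
    rw [ellNorm, if_neg ENNReal.ofReal_ne_top, ENNReal.toReal_ofReal hr.le, weightedLpNorm]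
    congr 3
    ext I
    rw [ENNReal.mul_rpow_of_nonneg _ _ hr.le, ← ENNReal.rpow_mul, one_div_mul_cancel hr.ne',
      ENNReal.rpow_one]
  obtain ⟨C, hC⟩ := exists_ellNorm_add_le (ι := D) (ENNReal.ofReal_pos.2 hr)
  refine ⟨?_, fun f => ?_, C + 1, le_add_self, fun f g => ?_⟩
  · simp [weightedLpNorm, hr]
  · simp [weightedLpNorm]
  · rw [hE, hE, hE]
    refine le_trans (ellNorm_mono fun I => ?_)
      ((hC (fun I => ‖(u I : ℂ) * f I‖ₑ * ν I ^ (1 / r))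
        fun I => ‖(u I : ℂ) * g I‖ₑ * ν I ^ (1 / r)).trans ?_)
    · rw [Pi.add_apply, mul_add, ← add_mul]
      gcongr
      exact enorm_add_le _ _
    · gcongr
      exact_mod_cast le_self_add

/-! ### Besov sequence spaces as weighted Lebesgue spaces -/

theorem size_pos {d : ℕ} (Q : Index d) : 0 < size Q := by
  rcases Q with k | ⟨F, k⟩
  · rw [size_inl]; exact one_pos
  · rw [size_inr]; positivity

theorem ofReal_rpow_mul_enorm_rpow {x : ℝ} (hx : 0 < x) {w e α r : ℝ} (hr : 0 < r)
    (h : w * r = e * r + α) (z : ℂ) :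
    (ENNReal.ofReal (x ^ w) * ‖z‖ₑ) ^ r =
      ‖((x ^ e : ℝ) : ℂ) * z‖ₑ ^ r * ENNReal.ofReal (x ^ α) := by
  have he : ‖((x ^ e : ℝ) : ℂ)‖ₑ = ENNReal.ofReal (x ^ e) := by
    rw [← ofReal_norm, Complex.norm_real, Real.norm_of_nonneg (by positivity)]
  rw [enorm_mul, he, ENNReal.mul_rpow_of_nonneg _ _ hr.le, ENNReal.mul_rpow_of_nonneg _ _ hr.le,
    ENNReal.ofReal_rpow_of_pos (by positivity), ENNReal.ofReal_rpow_of_pos (by positivity),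
    ← Real.rpow_mul hx.le, ← Real.rpow_mul hx.le, mul_right_comm,
    ← ENNReal.ofReal_mul (by positivity), ← Real.rpow_add hx, h]

/-- With both indices equal to `r`, the nested sums collapse to one, and `h` matches the powers of
`|Q|`. Coarse cubes have measure 1, so their weights vanish. Only `A^(1/r) + B^(1/r)` versus `(A +
B)^(1/r)` remains to compare. -/
theorem besovNorm_equivalent {d : ℕ} {γ e α r : ℝ} (hr : 0 < r)
    (h : (-γ + 1 / r - 1 / 2) * r = e * r + α) {u : Index d → ℝ}
    (hu : ∀ Q, u Q = size Q ^ e) :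
    Dominated (besovNorm (d := d) γ (ENNReal.ofReal r) (ENNReal.ofReal r))
        (weightedLpNorm u (nu α) r) ∧
      Dominated (weightedLpNorm u (nu α) r)
        (besovNorm (d := d) γ (ENNReal.ofReal r) (ENNReal.ofReal r)) := by
  set A : (Index d → ℂ) → ℝ≥0∞ := fun a =>
    ∑' k, ‖(u (Sum.inl k) : ℂ) * a (Sum.inl k)‖ₑ ^ r * nu α (Sum.inl k : Index d) with hA
  set B : (Index d → ℂ) → ℝ≥0∞ := fun a =>
    ∑' I, ‖(u (Sum.inr I) : ℂ) * a (Sum.inr I)‖ₑ ^ r * nu α (Sum.inr I : Index d) with hB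
  have hLp : ∀ a, weightedLpNorm u (nu α) r a = (A a + B a) ^ (1 / r) := by
    intro a
    rw [weightedLpNorm, Summable.tsum_sum ENNReal.summable ENNReal.summable]
  have hbes : ∀ a, besovNorm γ (ENNReal.ofReal r) (ENNReal.ofReal r) a =
      A a ^ (1 / r) + B a ^ (1 / r) := by
    intro a
    simp only [besovNorm, ellNorm, if_neg ENNReal.ofReal_ne_top, ENNReal.toReal_ofReal hr.le]
    congr 2
    · rw [hA]
      congr 1
      ext k
      simp [hu, size_inl, nu]
    · simp_rw [← ENNReal.rpow_mul, one_div_mul_cancel hr.ne', ENNReal.rpow_one]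
      simp only [hB]
      rw [ENNReal.tsum_prod']
      congr 1
      ext F
      congr 1
      ext k
      rw [hu, nu]
      refine ofReal_rpow_mul_enorm_rpow (size_pos _) hr ?_ _
      rw [← h, ENNReal.toReal_inv, ENNReal.toReal_ofReal hr.le, one_div r]
  constructor
  · refine ⟨2, fun a => ?_⟩
    rw [hLp, hbes, ENNReal.coe_ofNat, two_mul]
    gcongr
    · exact le_self_add
    · exact le_add_self
  · refine ⟨2 ^ (1 / r), fun a => ?_⟩
    rw [hLp, hbes, coe_two_rpow]
    exact add_rpow_le_two_rpow_mul (by positivity) _ _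

end Shearlet

/-! ### Interpolation of the Besov approximation, Lorentz and Besov sequence spaces -/

theorem theoremt (d : ℕ) (hd : 2 ≤ d) (s₁ s₂ p₁ : ℝ) (hp₁ : 0 < p₁)
    (p₂ : ℝ≥0∞) (hp₂ : 0 < p₂)
    (α : ℝ) (hα : α = p₁ * (s₂ - (p₂⁻¹).toReal - s₁ + 1 / p₁))
    (u : Shearlet.Index d → ℝ)
    (hu : ∀ Q, u Q = Shearlet.size Q ^ (-s₂ + (p₂⁻¹).toReal - 1 / 2))
    (ξ₀ ξ₁ : ℝ) (hξ₀ : 0 < ξ₀) (hξ₁ : 0 < ξ₁)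
    (r₀ r₁ : ℝ) (hr₀ : 1 / r₀ = ξ₀ + 1 / p₁) (hr₁ : 1 / r₁ = ξ₁ + 1 / p₁) :
    -- part i)
    (ξ₀ ≠ ξ₁ → ∀ μ₀ μ₁ : ℝ≥0∞, 0 < μ₀ → 0 < μ₁ →
      ∀ θ ∈ Ioo (0 : ℝ) 1, ∀ μ : ℝ≥0∞, 0 < μ → ∀ ξ r : ℝ,
      ξ = (1 - θ) * ξ₀ + θ * ξ₁ → 1 / r = (1 - θ) / r₀ + θ / r₁ →
        Shearlet.SameSpace
          (Shearlet.interpNorm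
            (Shearlet.approxNorm (Shearlet.besovNorm (d := d) s₁ (ENNReal.ofReal p₁)
              (ENNReal.ofReal p₁)) (Shearlet.nu α) ξ₀ μ₀)
            (Shearlet.approxNorm (Shearlet.besovNorm (d := d) s₁ (ENNReal.ofReal p₁)
              (ENNReal.ofReal p₁)) (Shearlet.nu α) ξ₁ μ₁) θ μ)
          (Shearlet.approxNorm (Shearlet.besovNorm (d := d) s₁ (ENNReal.ofReal p₁)
              (ENNReal.ofReal p₁)) (Shearlet.nu α) ξ μ) ∧
        1 / r = ξ + 1 / p₁ ∧
        Shearlet.SameSpace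
          (Shearlet.interpNorm
            (Shearlet.weightedLorentzNorm u (Shearlet.nu α) r₀ μ₀)
            (Shearlet.weightedLorentzNorm u (Shearlet.nu α) r₁ μ₁) θ μ)
          (Shearlet.weightedLorentzNorm u (Shearlet.nu α) r μ)) ∧
    -- part ii)
    (∀ θ ∈ Ioo (0 : ℝ) 1, ∀ ξ r γ₀ γ₁ γ : ℝ,
      ξ = (1 - θ) * ξ₀ + θ * ξ₁ → 1 / r = (1 - θ) / r₀ + θ / r₁ →
      γ₀ = s₁ + ξ₀ * (1 - α) → γ₁ = s₁ + ξ₁ * (1 - α) → γ = (1 - θ) * γ₀ + θ * γ₁ →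
        γ = s₁ + ξ * (1 - α) ∧
        Shearlet.SameSpace
          (Shearlet.interpNorm
            (Shearlet.besovNorm (d := d) γ₀ (ENNReal.ofReal r₀) (ENNReal.ofReal r₀))
            (Shearlet.besovNorm (d := d) γ₁ (ENNReal.ofReal r₁) (ENNReal.ofReal r₁))
            θ (ENNReal.ofReal r))
          (Shearlet.besovNorm (d := d) γ (ENNReal.ofReal r) (ENNReal.ofReal r))) := by
  open Shearlet in
  have hr₀pos : 0 < r₀ := one_div_pos.1 (by rw [hr₀]; positivity)
  have hr₁pos : 0 < r₁ := one_div_pos.1 (by rw [hr₁]; positivity)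
  have hr : ∀ θ ξ r : ℝ, ξ = (1 - θ) * ξ₀ + θ * ξ₁ → 1 / r = (1 - θ) / r₀ + θ / r₁ →
      1 / r = ξ + 1 / p₁ := by
    intro θ ξ r hξ h
    rw [h, hξ, div_eq_mul_one_div (1 - θ), div_eq_mul_one_div θ, hr₀, hr₁]
    ring
  -- One weight `u` and one measure `ν_α` serve the whole scale: the smoothness `s₁ + ξ(1 - α)` is
  -- what makes the exponents of `|Q|` agree.
  have hbesov : ∀ ξ r : ℝ, 0 < r → 1 / r = ξ + 1 / p₁ →
      Dominated (besovNorm (d := d) (s₁ + ξ * (1 - α)) (ENNReal.ofReal r) (ENNReal.ofReal r))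
          (weightedLpNorm u (nu α) r) ∧
        Dominated (weightedLpNorm u (nu α) r)
          (besovNorm (d := d) (s₁ + ξ * (1 - α)) (ENNReal.ofReal r) (ENNReal.ofReal r)) := by
    intro ξ r hrpos h
    refine besovNorm_equivalent hrpos ?_ hu
    have h1 : s₂ - (p₂⁻¹).toReal = α * (1 / p₁) + s₁ - 1 / p₁ := by
      rw [hα]
      field_simp
      ring
    have h2 : (1 / r) * r = 1 := one_div_mul_cancel hrpos.ne'
    have h3 : ξ = 1 / r - 1 / p₁ := by rw [h]; ring
    have h4 : -s₂ + (p₂⁻¹).toReal - 1 / 2 = -(α * (1 / p₁) + s₁ - 1 / p₁) - 1 / 2 := by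
      rw [← h1]; ring
    rw [h4, h3]
    linear_combination α * h2
  have hquasi : IsQuasiNorm (besovNorm (d := d) s₁ (ENNReal.ofReal p₁) (ENNReal.ofReal p₁)) := by
    -- At `ξ = 0` the scale contains the ambient Besov space itself, which gets its quasi-triangle
    -- inequality from the weighted Lebesgue space.
    have h := hbesov 0 p₁ hp₁ (zero_add _).symm
    rw [zero_mul, add_zero] at h
    exact (isQuasiNorm_weightedLpNorm u (nu α) hp₁).of_dominated h.1 h.2
      fun f => by simp [besovNorm]
  have hlorentz : ξ₀ ≠ ξ₁ → ∀ μ₀ μ₁ : ℝ≥0∞, 0 < μ₀ → 0 < μ₁ → ∀ θ ∈ Ioo (0 : ℝ) 1,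
      ∀ μ : ℝ≥0∞, 0 < μ → ∀ r : ℝ, 1 / r = (1 - θ) / r₀ + θ / r₁ →
      Dominated (interpNorm (weightedLorentzNorm u (nu α) r₀ μ₀)
          (weightedLorentzNorm u (nu α) r₁ μ₁) θ μ) (weightedLorentzNorm u (nu α) r μ) ∧
        Dominated (weightedLorentzNorm u (nu α) r μ)
          (interpNorm (weightedLorentzNorm u (nu α) r₀ μ₀)
            (weightedLorentzNorm u (nu α) r₁ μ₁) θ μ) := by
    intro hne μ₀ μ₁ hμ₀ hμ₁ θ hθ μ hμ r h
    simp only [weightedLorentzNorm_eq_approxNorm]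
    refine interpNorm_approxNorm (isQuasiNorm_weightedSupNorm u) (nu α) (one_div_pos.2 hr₀pos)
      (one_div_pos.2 hr₁pos) ?_ hθ ?_ hμ₀ hμ₁ hμ
    · rw [hr₀, hr₁]
      exact fun hc => hne (add_right_cancel hc)
    · rw [h]
      ring
  refine ⟨fun hne μ₀ μ₁ hμ₀ hμ₁ θ hθ μ hμ ξ r hξ h => ⟨?_, hr θ ξ r hξ h, ?_⟩,
    fun θ hθ ξ r γ₀ γ₁ γ hξ h hγ₀ hγ₁ hγ => ?_⟩
  · have := interpNorm_approxNorm hquasi (nu α) hξ₀ hξ₁ hne hθ hξ hμ₀ hμ₁ hμ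
    exact sameSpace_of_dominated this.1 this.2
  · have := hlorentz hne μ₀ μ₁ hμ₀ hμ₁ θ hθ μ hμ r h
    exact sameSpace_of_dominated this.1 this.2
  · have hγ' : γ = s₁ + ξ * (1 - α) := by
      rw [hγ, hγ₀, hγ₁, hξ]
      ring
    refine ⟨hγ', ?_⟩
    have hrpos : 0 < r := by
      have h0 := hθ.1
      have h1 : 0 < 1 - θ := by linarith [hθ.2]
      exact one_div_pos.1 (by rw [h]; positivity)
    have hr' := ENNReal.ofReal_pos.2 hrpos
    -- Part ii) allows equal exponents, where the approximation scale degenerates.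
    rcases eq_or_ne ξ₀ ξ₁ with heq | hne
    · have e₁ : r₁ = r₀ := by
        rw [← one_div_one_div r₁, hr₁, ← heq, ← hr₀, one_div_one_div]
      have eξ : ξ = ξ₀ := by rw [hξ, ← heq]; ring
      have e : r = r₀ := by
        rw [← one_div_one_div r, hr θ ξ r hξ h, eξ, ← hr₀, one_div_one_div]
      have eγ₁ : γ₁ = γ₀ := by rw [hγ₀, hγ₁, heq]
      have eγ : γ = γ₀ := by rw [hγ', hγ₀, eξ]
      have hb := hbesov ξ₀ r₀ hr₀pos hr₀
      rw [← hγ₀] at hb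
      have hq := (isQuasiNorm_weightedLpNorm u (nu α) hr₀pos).of_dominated hb.1 hb.2
        fun f => by simp [besovNorm]
      rw [eγ₁, eγ, e₁, e]
      rw [e] at hr'
      have := interpNorm_self hq hθ hr'
      exact sameSpace_of_dominated this.1 this.2
    · have hb₀ := hbesov ξ₀ r₀ hr₀pos hr₀
      have hb₁ := hbesov ξ₁ r₁ hr₁pos hr₁
      have hb := hbesov ξ r hrpos (hr θ ξ r hξ h)
      have hL := hlorentz hne _ _ (ENNReal.ofReal_pos.2 hr₀pos) (ENNReal.ofReal_pos.2 hr₁pos) θ hθ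
        _ hr' r h
      simp only [weightedLorentzNorm_eq_weightedLpNorm u (nu α) hr₀pos,
        weightedLorentzNorm_eq_weightedLpNorm u (nu α) hr₁pos,
        weightedLorentzNorm_eq_weightedLpNorm u (nu α) hrpos] at hL
      rw [hγ₀, hγ₁, hγ']
      exact sameSpace_of_dominated
        ((dominated_interpNorm hr' hb₀.1 hb₁.1).trans (hL.1.trans hb.2))
        (hb.1.trans (hL.2.trans (dominated_interpNorm hr' hb₀.2 hb₁.2)))
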